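/- All schemes are noetherian. Let $\varphi: E\to F$ be a homomorphism between locally free sheaves of finite rank on a scheme $X$ (not necessarily irreducible or reduced), and let $m$ be the rank of the image sheaf of $\varphi$, i.e. the smallest integer $m\ge 0$ with $\bigwedge^{m+1}\varphi=0$. For a homomorphism $\psi$ between locally free sheaves of finite rank on a scheme $Y$ let $\mathcal I_{\psi,r}\subseteq\mathcal O_Y$ be the ideal sheaf generated by the $(r+1)\times(r+1)$ minors of the local matrix representations of $\psi$. The *iterated determinantal blowup* $b:\widetilde X\to X$ of $X$ for $\varphi$ is obtained from $X$ by $m$ successive blowups: $X_0$ is the blowup of $X$ along $\mathcal I_{\varphi,0}$; for $0\le r\le m-2$, $X_{r+1}$ is the blowup of $X_r$ along $\mathcal I_{\varphi_r,r+1}$, where $\varphi_r$ is the pullback of $\varphi$ to $X_r$; and $\widetilde X=X_{m-1}$ (with $\widetilde X=X$ if $m=0$). A homomorphism $\psi: G\to H$ between locally free sheaves of finite rank on $Y$ is *locally diagonalizable* if $Y$ is covered by open sets $U$ such that there are decompositions $G|_U=G_0\oplus\bigoplus_{i=1}^{l}G_i$, $H|_U=H_0\oplus\bigoplus_{i=1}^{l}H_i$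 into free sheaves of finite rank, isomorphisms $I_i:G_i\to H_i$ and nonzero $p_i\in\Gamma(U,\mathcal O_Y)$, $1\le i\le l$, with $\psi|_{G_0}=0$, $\psi|_{G_i}=p_iI_i$, and $\langle p_i\rangle\supsetneq\langle p_{i+1}\rangle$ for all $1\le i<l$. A point $x\in X$ is *$\varphi$-regular* if some $m\times m$ minor of a local matrix representation of $\varphi$ near $x$ does not vanish at $x$. Let $f: Z\to X$ be a dominant morphism of schemes that maps every associated point of $Z$ to a $\varphi$-regular point of $X$ (this is automatic if $X$ and $Z$ are integral). If $f^*\varphi: f^*E\to f^*F$ is locally diagonalizable, then $f$ factors uniquely through $\widetilde X$: there is exactly one morphism $g: Z\to\widetilde X$ with $b\circ g=f$. -/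

import Mathlib

universe u

open CategoryTheory AlgebraicGeometry

noncomputable section

section BlowUp

open Polynomial HomogeneousLocalization

/-! ### Blow-ups -/

namespace GradedLoc

open HomogeneousIdeal Graded

variable {A B σ τ : Type u} [CommRing A] [SetLike σ A] [AddSubgroupClass σ A]
  [CommRing B] [SetLike τ B] [AddSubgroupClass τ B]
  {𝒜 : ℕ → σ} {ℬ : ℕ → τ} [GradedRing 𝒜] [GradedRing ℬ]

/-- `g` exhibits the graded ring `B` as the localization of the graded ring `A` at the element
`r` of degree zero. -/
structure IsAway (g : 𝒜 →+*ᵍ ℬ) (r : 𝒜 0) : Prop where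
  isUnit : IsUnit (g r)
  surj : ∀ b : B, ∃ (k : ℕ) (a : A), g r ^ k * b = g a
  eq_zero : ∀ a : A, g a = 0 → ∃ k : ℕ, (r : A) ^ k * a = 0

/-- The map in degree zero induced by a homomorphism of graded rings. -/
def zeroHom (g : 𝒜 →+*ᵍ ℬ) : 𝒜 0 →+* ℬ 0 where
  toFun a := ⟨g a, map_mem g a.2⟩
  map_one' := Subtype.ext (map_one g)
  map_mul' a b := Subtype.ext (map_mul g (a : A) b)
  map_zero' := Subtype.ext (map_zero g)
  map_add' a b := Subtype.ext (map_add g (a : A) b)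

lemma map_toSpecZero (g : 𝒜 →+*ᵍ ℬ) (hg : ℬ₊ ≤ 𝒜₊.map g) :
    Proj.map g hg ≫ Proj.toSpecZero 𝒜 =
      Proj.toSpecZero ℬ ≫ Spec.map (CommRingCat.ofHom (zeroHom g)) := by
  suffices H : ∀ (n : ℕ) (hn : 0 < n) (s : A) (hs : s ∈ 𝒜 n),
      Proj.awayι ℬ (g s) (g.2 hs) hn ≫ Proj.map g hg ≫ Proj.toSpecZero 𝒜 =
        Proj.awayι ℬ (g s) (g.2 hs) hn ≫
          Proj.toSpecZero ℬ ≫ Spec.map (CommRingCat.ofHom (zeroHom g)) from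
    (Proj.mapAffineOpenCover g hg).openCover.hom_ext _ _ fun i => H i.1 i.1.2 i.2 i.2.2
  intro n hn s hs
  rw [Proj.awayι_comp_map_assoc g hg hn s hs, Proj.awayι_toSpecZero,
    Proj.awayι_toSpecZero_assoc, ← Spec.map_comp,
    ← Spec.map_comp, ← CommRingCat.ofHom_comp, ← CommRingCat.ofHom_comp]
  congr 2
  ext a
  change (Away.map g _ (HomogeneousLocalization.mk _)).val = (HomogeneousLocalization.mk _).val
  rw [Away.map, HomogeneousLocalization.map_mk]
  simp [zeroHom]

variable {g : 𝒜 →+*ᵍ ℬ} {r : 𝒜 0}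

lemma IsAway.surj_homogeneous (h : IsAway g r) {n : ℕ} {b : B} (hb : b ∈ ℬ n) :
    ∃ (k : ℕ) (a : A), a ∈ 𝒜 n ∧ g r ^ k * b = g a := by
  obtain ⟨k, a, hk⟩ := h.surj b
  refine ⟨k, DirectSum.decompose 𝒜 a n, SetLike.coe_mem _, ?_⟩
  have hr : g r ^ k * b ∈ ℬ n := by
    have := SetLike.mul_mem_graded (SetLike.pow_mem_graded k (map_mem g r.2)) hb
    simpa using this
  rw [GradedRingHom.map_directSumDecompose, ← hk, DirectSum.decompose_of_mem_same _ hr]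

lemma IsAway.zero_isUnit (h : IsAway g r) : IsUnit (zeroHom g r) := by
  have hr0 : g r ∈ ℬ 0 := map_mem g r.2
  obtain ⟨u, hu⟩ := h.isUnit.exists_right_inv
  refine IsUnit.of_mul_eq_one (DirectSum.decompose ℬ u 0) (Subtype.ext ?_)
  have := congr(((DirectSum.decompose ℬ $hu 0 : ℬ 0) : B))
  rw [DirectSum.decompose_of_mem_same ℬ SetLike.GradedOne.one_mem] at this
  refine Eq.trans ?_ this
  exact (DirectSum.coe_decompose_mul_of_left_mem_zero ℬ (b := u) (j := 0) hr0).symm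

lemma IsAway.irrelevant_le (h : IsAway g r) : HomogeneousIdeal.irrelevant ℬ ≤
    (HomogeneousIdeal.irrelevant 𝒜).map g := by
  refine (HomogeneousIdeal.irrelevant_le ℬ).2 fun i hi b hb => ?_
  obtain ⟨k, a, ha, hk⟩ := h.surj_homogeneous hb
  obtain ⟨u, hu⟩ := h.isUnit.pow k
  have : b = ↑u⁻¹ * g a := by rw [← hk, ← hu, Units.inv_mul_cancel_left]
  change b ∈ Ideal.map g (𝒜₊).toIdeal
  rw [this]
  exact Ideal.mul_mem_left _ _ (Ideal.mem_map_of_mem _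
    (HomogeneousIdeal.mem_irrelevant_of_mem _ hi ha))

lemma IsAway.isLocalization (h : IsAway g r) {s : A} {d : ℕ} (hs : s ∈ 𝒜 d) :
    letI := (Away.map g s).toAlgebra
    IsLocalization.Away (fromZeroRingHom 𝒜 (Submonoid.powers s) r) (Away ℬ (g s)) := by
  let := (Away.map g s).toAlgebra
  have hr0 : g r ∈ ℬ 0 := map_mem g r.2
  have hmap : algebraMap (Away 𝒜 s) (Away ℬ (g s)) (fromZeroRingHom 𝒜 (Submonoid.powers s) r) =
      fromZeroRingHom ℬ (Submonoid.powers (g s)) ⟨g r, hr0⟩ := by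
    change Away.map g s (HomogeneousLocalization.mk _) = HomogeneousLocalization.mk _
    rw [Away.map, HomogeneousLocalization.map_mk]
    ext
    simp
  have hval (k : ℕ) : (fromZeroRingHom ℬ (Submonoid.powers (g s)) ⟨g r, hr0⟩ ^ k).val =
      Localization.mk (g r ^ k) 1 := by
    rw [val_pow]
    change (HomogeneousLocalization.mk _).val ^ k = _
    rw [val_mk]
    exact (Localization.mk_pow k _ _).trans (congrArg _ (one_pow k))
  have hval' (k : ℕ) : (fromZeroRingHom 𝒜 (Submonoid.powers s) r ^ k).val =
      Localization.mk ((r : A) ^ k) 1 := by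
    rw [val_pow]
    change (HomogeneousLocalization.mk _).val ^ k = _
    rw [val_mk]
    exact (Localization.mk_pow k _ _).trans (congrArg _ (one_pow k))
  constructor; constructor
  · rintro ⟨_, k, rfl⟩
    change IsUnit (algebraMap _ _ (fromZeroRingHom 𝒜 (Submonoid.powers s) r ^ k))
    rw [map_pow, hmap, ← map_pow]
    refine IsUnit.map _ (IsUnit.pow _ ?_)
    exact h.zero_isUnit
  · intro z
    obtain ⟨n, b, hb, rfl⟩ := Away.mk_surjective ℬ (map_mem g hs) z
    obtain ⟨k, a, ha, hk⟩ := h.surj_homogeneous hb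
    refine ⟨⟨Away.mk 𝒜 hs n a ha, ⟨_, ⟨k, rfl⟩⟩⟩, ?_⟩
    change _ * algebraMap _ _ (fromZeroRingHom 𝒜 (Submonoid.powers s) r ^ k) = Away.map g s _
    rw [map_pow, hmap]
    ext
    rw [val_mul, hval, Away.map_mk, Away.val_mk, Away.val_mk, Localization.mk_mul,
      Localization.mk_eq_mk_iff, Localization.r_iff_exists]
    exact ⟨1, by simp [← hk, mul_comm]⟩
  · intro a b e
    obtain ⟨n, a, ha, rfl⟩ := Away.mk_surjective 𝒜 hs a
    obtain ⟨m, b, hb, rfl⟩ := Away.mk_surjective 𝒜 hs b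
    change Away.map g s _ = Away.map g s _ at e
    replace e := congr_arg val e
    rw [Away.map_mk, Away.map_mk, Away.val_mk, Away.val_mk,
      Localization.mk_eq_mk_iff, Localization.r_iff_exists] at e
    obtain ⟨⟨_, k, rfl⟩, hc⟩ := e
    have hc' : g (s ^ k * (s ^ m * a) - s ^ k * (s ^ n * b)) = 0 := by
      simpa [sub_eq_zero] using hc
    obtain ⟨j, hj⟩ := h.eq_zero _ hc'
    refine ⟨⟨_, j, rfl⟩, ?_⟩
    change fromZeroRingHom 𝒜 (Submonoid.powers s) r ^ j * _ =
      fromZeroRingHom 𝒜 (Submonoid.powers s) r ^ j * _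
    ext
    rw [val_mul, val_mul, hval', Away.val_mk, Away.val_mk, Localization.mk_mul, Localization.mk_mul,
      Localization.mk_eq_mk_iff, Localization.r_iff_exists]
    refine ⟨⟨_, k, rfl⟩, ?_⟩
    simp only [one_mul]
    rw [mul_sub, sub_eq_zero] at hj
    convert! hj using 1 <;> ring

lemma IsAway.isOpenImmersion_awayMap (h : IsAway g r) {s : A} {d : ℕ} (hs : s ∈ 𝒜 d) :
    IsOpenImmersion (Spec.map (CommRingCat.ofHom (Away.map g s))) := by
  let := (Away.map g s).toAlgebra
  have := h.isLocalization hs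
  exact IsOpenImmersion.of_isLocalization (fromZeroRingHom 𝒜 (Submonoid.powers s) r)

lemma IsAway.injective (h : IsAway g r) : Function.Injective (Proj.map g h.irrelevant_le) := by
  intro p q hpq
  have key : ∀ p : Proj ℬ, ∀ b : B, b ∈ p.asHomogeneousIdeal ↔ ∀ (k : ℕ) (a : A), 
      g r ^ k * b = g a → a ∈ (Proj.map g h.irrelevant_le p).asHomogeneousIdeal := by
    intro p b
    change _ ↔ ∀ (k : ℕ) (a : A), g r ^ k * b = g a → g a ∈ p.asHomogeneousIdeal
    constructor
    · intro hb k a hk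
      rw [← hk]
      exact Ideal.mul_mem_left _ _ hb
    · intro H
      obtain ⟨k, a, hk⟩ := h.surj b
      have := H k a hk
      rw [← hk] at this
      exact (Ideal.unit_mul_mem_iff_mem _ (h.isUnit.pow k)).1 this
  refine ProjectiveSpectrum.ext (HomogeneousIdeal.ext (Ideal.ext fun b => ?_))
  exact (key p b).trans ((by rw [hpq] : _ ↔ _).trans (key q b).symm)

lemma IsAway.isOpenImmersion (h : IsAway g r) : IsOpenImmersion (Proj.map g h.irrelevant_le) := by
  suffices H : ∀ (n : ℕ) (hn : 0 < n) (s : A) (hs : s ∈ 𝒜 n), IsOpenImmersion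
      (Proj.awayι ℬ (g s) (g.2 hs) hn ≫ Proj.map g h.irrelevant_le) from
    IsOpenImmersion.of_openCover_source _
      (Proj.mapAffineOpenCover g h.irrelevant_le).openCover h.injective fun i => H i.1 i.1.2 i.2 i.2.2
  intro n hn s hs
  have := h.isOpenImmersion_awayMap hs
  rw [Proj.awayι_comp_map g h.irrelevant_le hn s hs]
  infer_instance

lemma IsAway.opensRange (h : IsAway g r) : 
    letI := h.isOpenImmersion
    (Proj.map g h.irrelevant_le).opensRange =
    Proj.toSpecZero 𝒜 ⁻¹ᵁ PrimeSpectrum.basicOpen r := by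
  let := h.isOpenImmersion
  ext p
  constructor
  · rintro ⟨q, rfl⟩
    change Proj.toSpecZero 𝒜 (Proj.map g h.irrelevant_le q) ∈ PrimeSpectrum.basicOpen r
    rw [← Scheme.Hom.comp_apply, map_toSpecZero, Scheme.Hom.comp_apply]
    generalize Proj.toSpecZero ℬ q = x
    change zeroHom g r ∉ PrimeSpectrum.asIdeal (R := ℬ 0) x
    intro hx
    obtain ⟨u, hu⟩ := h.zero_isUnit.exists_right_inv
    exact x.2.ne_top ((Ideal.eq_top_iff_one _).2 (hu ▸ Ideal.mul_mem_right _ _ hx))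
  · intro hp
    suffices H : ∀ (n : ℕ) (hn : 0 < n) (s : A) (hs : s ∈ 𝒜 n) (t : Spec (.of (Away 𝒜 s))),
        Proj.toSpecZero 𝒜 (Proj.awayι 𝒜 s hs hn t) ∈ PrimeSpectrum.basicOpen r →
        Proj.awayι 𝒜 s hs hn t ∈ Set.range (Proj.map g h.irrelevant_le) by
      obtain ⟨t, ht⟩ := (Proj.affineOpenCover 𝒜).openCover.covers p
      have := H _ (Scheme.Cover.idx (Proj.affineOpenCover 𝒜).openCover p).1.2 _
        (Scheme.Cover.idx (Proj.affineOpenCover 𝒜).openCover p).2.2 t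
      change _ ∈ Set.range (Proj.map g h.irrelevant_le)
      rw [← ht]
      refine this ?_
      change Proj.toSpecZero 𝒜 ((Proj.affineOpenCover 𝒜).openCover.f _ t) ∈ _
      rw [ht]
      exact hp
    intro n hn s hs t hp
    have hp' : (Proj.awayι 𝒜 s hs hn ≫ Proj.toSpecZero 𝒜) t ∈ PrimeSpectrum.basicOpen r := hp
    have e0 := Proj.awayι_toSpecZero 𝒜 s hs hn
    generalize Proj.awayι 𝒜 s hs hn ≫ Proj.toSpecZero 𝒜 = F at e0 hp'
    subst e0
    let := (Away.map g s).toAlgebra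
    have hloc := h.isLocalization hs
    have hr := PrimeSpectrum.localization_away_comap_range (Away ℬ (g s))
      (fromZeroRingHom 𝒜 (Submonoid.powers s) r)
    obtain ⟨t', ht'⟩ : t ∈ Set.range
      (PrimeSpectrum.comap (algebraMap (Away 𝒜 s) (Away ℬ (g s)))) := hr ▸ hp'
    have e := Proj.awayι_comp_map g h.irrelevant_le hn s hs
    refine ⟨Proj.awayι ℬ (g s) (g.2 hs) hn t', ?_⟩
    let t'' : Spec (.of (Away ℬ (g s))) := t'
    rw [← ht']
    exact congr($e t'')

end GradedLoc

namespace ReesGrading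

variable {R : Type u} [CommRing R] (I : Ideal R)

/-- The degree `n` part `Iⁿ Xⁿ` of the Rees algebra of `I`. -/
def piece (n : ℕ) : AddSubgroup (reesAlgebra I) where
  carrier := {f | ∀ i, i ≠ n → (f : R[X]).coeff i = 0}
  zero_mem' := by simp
  add_mem' {f g} hf hg i hi := by simp [hf i hi, hg i hi]
  neg_mem' {f} hf i hi := by simp [hf i hi]

variable {I} in
lemma mem_piece {n : ℕ} {f : reesAlgebra I} :
    f ∈ piece I n ↔ ∀ i, i ≠ n → (f : R[X]).coeff i = 0 := Iff.rfl

/-- The homogeneous component of degree `n` of an element of the Rees algebra. -/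
def component (f : reesAlgebra I) (n : ℕ) : piece I n :=
  ⟨⟨monomial n ((f : R[X]).coeff n), reesAlgebra.monomial_mem.2 (f.2 n)⟩, fun i hi => by
    simp [coeff_monomial, hi.symm]⟩

instance : SetLike.GradedMonoid (piece I) where
  one_mem i hi := by simp [coeff_one, hi]
  mul_mem {m n f g} hf hg i hi := by
    simp only [MulMemClass.coe_mul, coeff_mul]
    refine Finset.sum_eq_zero fun x hx => ?_
    have hx' := Finset.HasAntidiagonal.mem_antidiagonal.1 hx
    by_cases h1 : x.1 = m
    · rw [hg x.2 (by omega), mul_zero]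
    · rw [hf x.1 h1, zero_mul]

lemma coeff_coe_directSum (x : DirectSum ℕ fun n => piece I n) (n : ℕ) :
    ((DirectSum.coeAddMonoidHom (piece I) x : reesAlgebra I) : R[X]).coeff n =
      ((x n : reesAlgebra I) : R[X]).coeff n := by
  induction x using DirectSum.induction_on with
  | zero => simp
  | of i x =>
    rw [DirectSum.coeAddMonoidHom_of]
    by_cases hi : i = n
    · subst hi; simp
    · rw [x.2 n (Ne.symm hi), DirectSum.of_eq_of_ne _ _ _ (Ne.symm hi)]; simp
  | add x y hx hy => simp [hx, hy]

lemma mk_component_apply (f : reesAlgebra I) (n : ℕ) :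
    DirectSum.mk (fun n => piece I n) (f : R[X]).support (fun n => component I f n) n =
      component I f n := by
  by_cases hn : n ∈ (f : R[X]).support
  · rw [DirectSum.mk_apply_of_mem hn]
  · rw [DirectSum.mk_apply_of_notMem hn]
    ext i
    simp [component, Polynomial.notMem_support_iff.1 hn]

instance : DirectSum.Decomposition (piece I) where
  decompose' f := DirectSum.mk _ (f : R[X]).support fun n => component I f n
  left_inv f := by
    ext n
    rw [coeff_coe_directSum, mk_component_apply]
    simp [component]
  right_inv x := by
    refine DFinsupp.ext fun n => ?_
    rw [mk_component_apply]
    ext i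
    by_cases hi : i = n
    · subst hi
      rw [← coeff_coe_directSum]
      simp [component]
    · rw [(x n).2 i hi, (component I _ n).2 i hi]

instance : GradedRing (piece I) where


variable {I} {S : Type u} [CommRing S] {J : Ideal S}

/-- The homomorphism of Rees algebras induced by a ring homomorphism `f` with `f(I) ⊆ J`. -/
def map (f : R →+* S) (h : I ≤ J.comap f) : piece I →+*ᵍ piece J where
  toRingHom := ((Polynomial.mapRingHom f).comp (reesAlgebra I).val.toRingHom).codRestrict
    (reesAlgebra J) fun a i => by
      have h1 : (I ^ i).map f ≤ J ^ i := by
        rw [Ideal.map_pow]; exact Ideal.pow_right_mono (Ideal.map_le_iff_le_comap.2 h) i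
      simpa using h1 (Ideal.mem_map_of_mem f (a.2 i))
  map_mem {n a} ha i hi := by
    simpa using by rw [ha i hi, map_zero]

@[simp] lemma coeff_map (f : R →+* S) (h : I ≤ J.comap f) (a : reesAlgebra I) (n : ℕ) :
    (map f h a : S[X]).coeff n = f ((a : R[X]).coeff n) := by
  change (Polynomial.map f (a : R[X])).coeff n = _
  simp

/-- The structure homomorphism from `R` to the degree zero part of the Rees algebra. -/
def algebraMapZero (I : Ideal R) : R →+* piece I 0 where
  toFun a := ⟨algebraMap R (reesAlgebra I) a, fun i hi => by
    change (C a).coeff i = 0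
    rw [coeff_C, if_neg hi]⟩
  map_one' := Subtype.ext (map_one _)
  map_mul' a b := Subtype.ext (map_mul _ a b)
  map_zero' := Subtype.ext (map_zero _)
  map_add' a b := Subtype.ext (map_add _ a b)

lemma zeroHom_algebraMapZero (f : R →+* S) (h : I ≤ J.comap f) :
    (GradedLoc.zeroHom (map f h)).comp (algebraMapZero I) = (algebraMapZero J).comp f := by
  ext a : 3
  ext n
  change (map f h (algebraMap R (reesAlgebra I) a) : S[X]).coeff n = (C (f a)).coeff n
  rw [coeff_map]
  change f ((C a).coeff n) = _
  rw [coeff_C, coeff_C]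
  split_ifs <;> simp

lemma isAway_map (f : R →+* S) (r : R)
    (hf : letI := f.toAlgebra; IsLocalization.Away r S) (hJ : I.map f = J) :
    GradedLoc.IsAway (map f (Ideal.map_le_iff_le_comap.1 hJ.le)) (algebraMapZero I r) := by
  let := f.toAlgebra
  have hf' : IsLocalization.Away r S := hf
  set g := map f (Ideal.map_le_iff_le_comap.1 hJ.le) with hg
  have hgr : g (algebraMapZero I r) = algebraMap S (reesAlgebra J) (f r) := by
    ext n
    change (map f _ (algebraMap R (reesAlgebra I) r) : S[X]).coeff n = (C (f r)).coeff n
    rw [coeff_map]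
    change f ((C r).coeff n) = _
    rw [coeff_C, coeff_C]
    split_ifs <;> simp
  have hpow (k : ℕ) (b : reesAlgebra J) (n : ℕ) :
      ((g (algebraMapZero I r) ^ k * b : reesAlgebra J) : S[X]).coeff n =
        f r ^ k * (b : S[X]).coeff n := by
    rw [hgr, ← map_pow]
    change (C (f r ^ k) * (b : S[X])).coeff n = _
    rw [coeff_C_mul]
  have hpow' (k : ℕ) (a : reesAlgebra I) (n : ℕ) :
      (((algebraMapZero I r : reesAlgebra I) ^ k * a : reesAlgebra I) : R[X]).coeff n =
        r ^ k * (a : R[X]).coeff n := by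
    change ((algebraMap R (reesAlgebra I) r ^ k * a : reesAlgebra I) : R[X]).coeff n = _
    rw [← map_pow]
    change (C (r ^ k) * (a : R[X])).coeff n = _
    rw [coeff_C_mul]
  refine ⟨?_, fun b => ?_, fun a ha => ?_⟩
  · rw [hgr]
    exact (IsLocalization.Away.algebraMap_isUnit (S := S) r).map _
  · have h1 (n : ℕ) : ∃ (k : ℕ) (x : R), x ∈ I ^ n ∧ f r ^ k * (b : S[X]).coeff n = f x := by
      have hb : (b : S[X]).coeff n ∈ (I ^ n).map (algebraMap R S) := by
        rw [Ideal.map_pow]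
        exact hJ ▸ b.2 n
      obtain ⟨⟨x, ⟨_, k, rfl⟩⟩, hx⟩ :=
        (IsLocalization.mem_map_algebraMap_iff (Submonoid.powers r) S).1 hb
      refine ⟨k, x, x.2, ?_⟩
      rw [mul_comm, ← map_pow]
      exact hx
    choose k x hx hk using h1
    let s := (b : S[X]).support
    let K := s.sup k
    refine ⟨K, ∑ n ∈ s, ⟨monomial n (r ^ (K - k n) * x n),
      reesAlgebra.monomial_mem.2 (Ideal.mul_mem_left _ _ (hx n))⟩, ?_⟩
    ext n
    rw [hpow, coeff_map]
    have : (((∑ n ∈ s, ⟨monomial n (r ^ (K - k n) * x n),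
      reesAlgebra.monomial_mem.2 (Ideal.mul_mem_left _ _ (hx n))⟩ : reesAlgebra I)) : R[X]) =
        ∑ n ∈ s, monomial n (r ^ (K - k n) * x n) := by
      rw [AddSubmonoidClass.coe_finsetSum]
    rw [this, finsetSum_coeff]
    simp only [coeff_monomial]
    rw [Finset.sum_ite_eq']
    split_ifs with hn
    · rw [map_mul, ← hk, map_pow, ← mul_assoc, ← pow_add,
        Nat.sub_add_cancel (Finset.le_sup (f := k) hn)]
    · rw [Polynomial.notMem_support_iff.1 hn]; simp
  · have h1 (n : ℕ) : ∃ k : ℕ, r ^ k * (a : R[X]).coeff n = 0 := by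
      have : algebraMap R S ((a : R[X]).coeff n) = 0 := by
        change f _ = 0
        have := congr((($ha : reesAlgebra J) : S[X]).coeff n)
        simpa [hg] using this
      obtain ⟨⟨_, k, rfl⟩, hk⟩ := (IsLocalization.map_eq_zero_iff (Submonoid.powers r) S _).1 this
      exact ⟨k, hk⟩
    choose k hk using h1
    let s := (a : R[X]).support
    refine ⟨s.sup k, ?_⟩
    ext n
    rw [hpow']
    by_cases hn : n ∈ s
    · rw [← Nat.sub_add_cancel (Finset.le_sup (f := k) hn), pow_add, mul_assoc, hk]; simp
    · rw [Polynomial.notMem_support_iff.1 hn]; simp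

/-- The blow-up of `Spec R` along the ideal `I`: the `Proj` of the Rees algebra. -/
abbrev affineBlowup (I : Ideal R) : Scheme.{u} := Proj (piece I)

/-- The structure morphism of the blow-up of `Spec R` along `I`. -/
def affineBlowupπ (I : Ideal R) : affineBlowup I ⟶ Spec (.of R) :=
  Proj.toSpecZero (piece I) ≫ Spec.map (CommRingCat.ofHom (algebraMapZero I))

lemma irrelevant_le (f : R →+* S) (r : R)
    (hf : letI := f.toAlgebra; IsLocalization.Away r S) (hJ : I.map f = J) :
    HomogeneousIdeal.irrelevant (piece J) ≤ (HomogeneousIdeal.irrelevant (piece I)).map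
      (map f (Ideal.map_le_iff_le_comap.1 hJ.le)) :=
  (isAway_map f r hf hJ).irrelevant_le

lemma projMap_affineBlowupπ (f : R →+* S) (h : I ≤ J.comap f)
    (hi : HomogeneousIdeal.irrelevant (piece J) ≤
      (HomogeneousIdeal.irrelevant (piece I)).map (map f h)) :
    Proj.map (map f h) hi ≫ affineBlowupπ I =
      affineBlowupπ J ≫ Spec.map (CommRingCat.ofHom f) := by
  rw [affineBlowupπ, affineBlowupπ, ← Category.assoc, GradedLoc.map_toSpecZero,
    Category.assoc, Category.assoc, ← Spec.map_comp, ← Spec.map_comp,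
    ← CommRingCat.ofHom_comp, ← CommRingCat.ofHom_comp, zeroHom_algebraMapZero]

lemma isPullback_affineBlowupπ (f : R →+* S) (r : R)
    (hf : letI := f.toAlgebra; IsLocalization.Away r S) (hJ : I.map f = J)
    (h : I ≤ J.comap f)
    (hi : HomogeneousIdeal.irrelevant (piece J) ≤
      (HomogeneousIdeal.irrelevant (piece I)).map (map f h)) :
    IsPullback (Proj.map (map f h) hi) (affineBlowupπ J) (affineBlowupπ I)
      (Spec.map (CommRingCat.ofHom f)) := by
  let := f.toAlgebra
  have hf' : IsLocalization.Away r S := hf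
  have ha := isAway_map f r hf hJ
  have h1 : IsOpenImmersion (Proj.map (map f h) hi) := ha.isOpenImmersion
  have h2 : IsOpenImmersion (Spec.map (CommRingCat.ofHom f)) :=
    IsOpenImmersion.of_isLocalization r
  have e1 : (Proj.map (map f h) hi).opensRange = Proj.toSpecZero (piece I) ⁻¹ᵁ
      PrimeSpectrum.basicOpen (algebraMapZero I r) := ha.opensRange
  have e2 : (Spec.map (CommRingCat.ofHom f)).opensRange = PrimeSpectrum.basicOpen r :=
    TopologicalSpace.Opens.ext (PrimeSpectrum.localization_away_comap_range S r)
  refine (IsOpenImmersion.isPullback (affineBlowupπ J) (Proj.map (map f h) hi)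
    (Spec.map (CommRingCat.ofHom f)) (affineBlowupπ I) (projMap_affineBlowupπ f h hi) ?_).flip
  rw [e1, e2]
  rfl

end ReesGrading

namespace AlgebraicGeometry.Scheme.IdealSheafData

open AffineZariskiSite

variable {X : Scheme.{u}} (I : X.IdealSheafData)

/-- The ideal of sections of an ideal sheaf over an affine open subset. -/
abbrev sections (U : X.AffineZariskiSite) : Ideal Γ(X, U.1) := I.ideal ⟨U.1, U.2⟩

lemma sections_le_comap {U V : X.AffineZariskiSite} (h : U ≤ V) :
    I.sections V ≤ (I.sections U).comap
      (X.presheaf.map (homOfLE (toOpens_mono h)).op).hom :=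
  I.ideal_le_comap_ideal (U := ⟨U.1, U.2⟩) (V := ⟨V.1, V.2⟩) (toOpens_mono h)

/-- Restriction of Rees algebras along `U ≤ V`. -/
def reesRes {U V : X.AffineZariskiSite} (h : U ≤ V) :
    ReesGrading.piece (I.sections V) →+*ᵍ ReesGrading.piece (I.sections U) :=
  ReesGrading.map _ (I.sections_le_comap h)

lemma exists_isLocalization {U V : X.AffineZariskiSite} (h : U ≤ V) :
    ∃ r : Γ(X, V.1),
      (letI := (X.presheaf.map (homOfLE (toOpens_mono h)).op).hom.toAlgebra
       IsLocalization.Away r Γ(X, U.1)) ∧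
      (I.sections V).map (X.presheaf.map (homOfLE (toOpens_mono h)).op).hom = I.sections U := by
  have h' := h
  obtain ⟨r, hr⟩ := h'
  obtain rfl : V.basicOpen r = U := Subtype.ext hr
  refine ⟨r, ?_, ?_⟩
  · exact V.2.isLocalization_basicOpen r
  · exact I.map_ideal (U := ⟨X.basicOpen r, V.2.basicOpen r⟩) (V := ⟨V.1, V.2⟩) (toOpens_mono h)

lemma reesRes_irrelevant {U V : X.AffineZariskiSite} (h : U ≤ V) :
    HomogeneousIdeal.irrelevant (ReesGrading.piece (I.sections U)) ≤
      (HomogeneousIdeal.irrelevant (ReesGrading.piece (I.sections V))).map (I.reesRes h) := by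
  obtain ⟨r, hr, hI⟩ := I.exists_isLocalization h
  exact ReesGrading.irrelevant_le _ r hr hI

/-- The blow-up of the affine open subscheme `U` along `I`. -/
def blowupChart (U : X.AffineZariskiSite) : Scheme.{u} :=
  ReesGrading.affineBlowup (I.sections U)

/-- The structure morphism of the affine blow-up to `Spec Γ(X, U)`. -/
def blowupChartToSpec (U : X.AffineZariskiSite) : I.blowupChart U ⟶ Spec Γ(X, U.1) :=
  ReesGrading.affineBlowupπ (I.sections U)

/-- The transition morphisms between the affine blow-ups. -/
def blowupChartMap {U V : X.AffineZariskiSite} (h : U ≤ V) :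
    I.blowupChart U ⟶ I.blowupChart V :=
  Proj.map (I.reesRes h) (I.reesRes_irrelevant h)

lemma proj_map_congr {A B σ τ : Type u} [CommRing A] [SetLike σ A] [AddSubgroupClass σ A]
    [CommRing B] [SetLike τ B] [AddSubgroupClass τ B]
    {𝒜 : ℕ → σ} {ℬ : ℕ → τ} [GradedRing 𝒜] [GradedRing ℬ] {f g : 𝒜 →+*ᵍ ℬ} (h : f = g)
    (hf : HomogeneousIdeal.irrelevant ℬ ≤ (HomogeneousIdeal.irrelevant 𝒜).map f)
    (hg : HomogeneousIdeal.irrelevant ℬ ≤ (HomogeneousIdeal.irrelevant 𝒜).map g) :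
    Proj.map f hf = Proj.map g hg := by
  subst h; rfl

lemma reesRes_refl (U : X.AffineZariskiSite) :
    I.reesRes (le_refl U) = GradedRingHom.id _ := by
  refine GradedRingHom.ext fun a => Subtype.ext (Polynomial.ext fun n => ?_)
  refine (ReesGrading.coeff_map _ (I.sections_le_comap (le_refl U)) a n).trans ?_
  simp

lemma reesRes_trans {U V W : X.AffineZariskiSite} (h : U ≤ V) (h' : V ≤ W) :
    I.reesRes (h.trans h') = (I.reesRes h).comp (I.reesRes h') := by
  refine GradedRingHom.ext fun a => Subtype.ext (Polynomial.ext fun n => ?_)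
  refine (ReesGrading.coeff_map _ (I.sections_le_comap (h.trans h')) a n).trans ?_
  refine Eq.trans ?_ (ReesGrading.coeff_map _ (I.sections_le_comap h) (I.reesRes h' a) n).symm
  refine Eq.trans ?_ (congrArg _ (ReesGrading.coeff_map _ (I.sections_le_comap h') a n).symm)
  rw [← CommRingCat.comp_apply, ← X.presheaf.map_comp]
  rfl

lemma isPullback_blowupChartMap {U V : X.AffineZariskiSite} (h : U ≤ V) :
    IsPullback (I.blowupChartMap h) (I.blowupChartToSpec U) (I.blowupChartToSpec V)
      (Spec.map (X.presheaf.map (homOfLE (toOpens_mono h)).op)) := by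
  obtain ⟨r, hr, hI⟩ := I.exists_isLocalization h
  exact ReesGrading.isPullback_affineBlowupπ _ r hr hI _ _

/-- The affine blow-ups, as a functor on the affine open subsets. -/
def blowupFunctor : X.AffineZariskiSite ⥤ Scheme.{u} where
  obj U := I.blowupChart U
  map h := I.blowupChartMap h.le
  map_id U := (proj_map_congr (I.reesRes_refl U) _ (by simp)).trans Proj.map_id
  map_comp h h' := (proj_map_congr (I.reesRes_trans h.le h'.le) _ _).trans
    (Proj.map_comp _ _ (I.reesRes_irrelevant h'.le) (I.reesRes_irrelevant h.le))

/-- The structure morphisms of the affine blow-ups, as a natural transformation. -/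
def blowupToSpec :
    I.blowupFunctor ⟶ toOpensFunctor X ⋙ X.presheaf.rightOp ⋙ Scheme.Spec where
  app U := I.blowupChartToSpec U
  naturality _ _ h := (I.isPullback_blowupChartMap h.le).w

lemma blowupToSpec_equifibered : NatTrans.Equifibered I.blowupToSpec :=
  fun _ _ h => I.isPullback_blowupChartMap h.le

/-- The data for gluing the affine blow-ups. -/
def blowupGluingData : (directedCover X).RelativeGluingData where
  functor := I.blowupFunctor
  natTrans := I.blowupToSpec ≫ (restrictIsoSpec X).inv
  equifibered := I.blowupToSpec_equifibered.comp
    (.of_isIso (restrictIsoSpec X).symm.hom)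

/-- The blow-up of `X` along the ideal sheaf `I`: the relative `Proj` of the Rees algebra
`⨁ Iⁿ`, glued from its restrictions to the affine open subschemes of `X`. -/
def blowup : Scheme.{u} := I.blowupGluingData.glued

/-- The structure morphism of the blow-up. -/
def blowupπ : I.blowup ⟶ X := I.blowupGluingData.toBase

end AlgebraicGeometry.Scheme.IdealSheafData

end BlowUp

namespace AlgebraicGeometry.Scheme.Modules

variable {X : Scheme.{u}} {E F : X.Modules}

/-- The finite family `e` of sections of `E` over `U` is a frame, i.e. it gives an isomorphism of
`E|_U` with the free sheaf on `ι`: its restriction to each smaller open set is a basis. -/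
def IsFrame (E : X.Modules) (U : X.Opens) {ι : Type} [Finite ι] (e : ι → Γ(E, U)) : Prop :=
  ∀ (V : X.Opens) (h : V ≤ U),
    LinearIndependent Γ(X, V) (fun i => E.presheaf.map (homOfLE h).op (e i)) ∧
    Submodule.span Γ(X, V) (Set.range fun i => E.presheaf.map (homOfLE h).op (e i)) = ⊤

/-- `E` is a locally free sheaf of finite (possibly non-constant) rank. -/
def IsLocallyFreeOfFiniteRank (E : X.Modules) : Prop :=
  ∀ x : X, ∃ (U : X.Opens) (n : ℕ) (e : Fin n → Γ(E, U)), x ∈ U ∧ IsFrame E U e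

/-- `a` is a `k × k` minor of a matrix that represents `φ` over the open set `U` with respect to
some frames of `E` and `F` over `U`. -/
def IsMinor (φ : E ⟶ F) (k : ℕ) (U : X.Opens) (a : Γ(X, U)) : Prop :=
  ∃ (p q : ℕ) (e : Fin p → Γ(E, U)) (h : Fin q → Γ(F, U)) (A : Matrix (Fin q) (Fin p) Γ(X, U))
    (s : Fin k → Fin q) (t : Fin k → Fin p),
    IsFrame E U e ∧ IsFrame F U h ∧ (∀ j, φ.app U (e j) = ∑ i, A i j • h i) ∧
    Function.Injective s ∧ Function.Injective t ∧ a = (A.submatrix s t).det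

/-- The ideal sheaf `I_{φ,r}` generated by the `(r + 1) × (r + 1)` minors of the local matrix
representations of `φ`: the smallest quasi-coherent ideal sheaf that contains them all. -/
def determinantalIdeal (φ : E ⟶ F) (r : ℕ) : X.IdealSheafData :=
  sInf {J | ∀ (U : X.affineOpens) (a : Γ(X, U)), IsMinor φ (r + 1) U a → a ∈ J.ideal U}

/-- The rank of the image sheaf of `φ`: the smallest `m` such that `⋀^(m+1) φ = 0`, i.e. such that
all `(m + 1) × (m + 1)` minors vanish. -/
def imageRank (φ : E ⟶ F) : ℕ :=
  sInf {m | ∀ (U : X.Opens) (a : Γ(X, U)), IsMinor φ (m + 1) U a → a = 0}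

/-- The point `x` is `φ`-regular: the rank of the fibre map `φ(x)` is the maximal one, i.e. some
minor of `φ` of size `imageRank φ` does not vanish at `x`. -/
def IsRegularPoint (φ : E ⟶ F) (x : X) : Prop :=
  ∃ (U : X.Opens) (a : Γ(X, U)), IsMinor φ (imageRank φ) U a ∧ x ∈ X.basicOpen a

/-- `φ` is diagonalizable over `U`: there are decompositions `E|_U = G₀ ⊕ ⨁ Gᵢ` and
`F|_U = H₀ ⊕ ⨁ Hᵢ` into free summands such that `φ` vanishes on `G₀` and is `pᵢ` times an
isomorphism `Gᵢ ≅ Hᵢ` on `Gᵢ`, where the `pᵢ` are nonzero functions on `U` and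
`⟨p₁⟩ ⊋ ⟨p₂⟩ ⊋ ⋯`. The frame `e` is made of frames of the `Gᵢ`, and `h` of their images in `Hᵢ`. -/
def IsDiagonalizableOn (φ : E ⟶ F) (U : X.Opens) : Prop :=
  ∃ (l a b : ℕ) (n : Fin l → ℕ)
    (e : Fin a ⊕ (Σ i : Fin l, Fin (n i)) → Γ(E, U))
    (h : Fin b ⊕ (Σ i : Fin l, Fin (n i)) → Γ(F, U)) (p : Fin l → Γ(X, U)),
    IsFrame E U e ∧ IsFrame F U h ∧
    (∀ i, p i ≠ 0) ∧ StrictAnti (fun i => Ideal.span {p i}) ∧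
    (∀ j, φ.app U (e (Sum.inl j)) = 0) ∧
    ∀ i j, φ.app U (e (Sum.inr ⟨i, j⟩)) = p i • h (Sum.inr ⟨i, j⟩)

/-- `φ` is diagonalizable over the members of some open covering. -/
def IsLocallyDiagonalizable (φ : E ⟶ F) : Prop :=
  ∀ x : X, ∃ U : X.Opens, x ∈ U ∧ IsDiagonalizableOn φ U

/-- The successive blow-ups of `X`: stage `0` is `X`, and stage `k + 1` is the blow-up of stage `k`
along the ideal sheaf of `(k + 1) × (k + 1)` minors of the pullback of `φ` to stage `k`. -/
def blowupTower (φ : E ⟶ F) : ℕ → Over X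
  | 0 => Over.mk (𝟙 X)
  | k + 1 => Over.mk
      ((determinantalIdeal ((pullback (blowupTower φ k).hom).map φ) k).blowupπ ≫
        (blowupTower φ k).hom)

/-- The iterated determinantal blow-up of `X` for `φ`: one blow-up for each size
`1, …, imageRank φ` of minors. -/
def detBlowup (φ : E ⟶ F) : Scheme.{u} := (blowupTower φ (imageRank φ)).left

/-- The structure morphism of the iterated determinantal blow-up. -/
def detBlowupπ (φ : E ⟶ F) : detBlowup φ ⟶ X := (blowupTower φ (imageRank φ)).hom

end AlgebraicGeometry.Scheme.Modules

/-- `z` is an associated point of the scheme `Z`: the maximal ideal of the local ring at `z` is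
an associated prime of the local ring. -/
def AlgebraicGeometry.Scheme.IsAssociatedPoint {Z : Scheme.{u}} (z : Z) : Prop :=
  IsLocalRing.maximalIdeal (Z.presheaf.stalk z) ∈
    associatedPrimes (Z.presheaf.stalk z) (Z.presheaf.stalk z)

end

/-! By the universal property of blowing up, it suffices that the ideal blown up at each stage
becomes invertible on `Z`, i.e. locally generated by a nonzerodivisor. Each stage then has a unique
lift of the previous lift, and induction up to `imageRank φ` gives the theorem.

Minor ideals do not depend on the chosen frames (`IsMatrixOf.minorIdeal_eq`), and frames pull back
to frames (`IsFrame.pullback`). So the inverse image on `Z` of the ideal of `(k + 1) × (k + 1)`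
minors can be read off from a diagonal matrix of the pullback of `φ` to `Z`. Its entries form a
divisibility chain. Every minor is a combination of products of `k + 1` entries, and the product of
the first `k + 1` entries divides all the others, so it generates the ideal. It is a nonzerodivisor:
otherwise it lies in an associated prime `P` of the noetherian ring of sections. It divides every
product of `m ≥ k + 1` entries, so all `m × m` minors would vanish at the associated point `P`,
although that point maps to a `φ`-regular one. The algebra is
`Matrix.exists_minorIdeal_diagonalBlock_eq_span`, the geometry
`isInvertibleAlong_determinantalIdeal`.

The universal property, `IsInvertibleAlong.existsUnique_blowup_lift`, is proved on affine pieces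
with the Rees algebra and then glued. There, if `I S = q S` with `q` a nonzerodivisor, the lift is
given by `b Xⁿ ↦ b / qⁿ`. -/

/-! ### Ideals of minors, and the diagonal case -/

namespace Matrix

variable {R S : Type*} [CommRing R] [CommRing S] {ι κ μ : Type*}

/-- The ideal generated by the `k × k` minors of a matrix. -/
def minorIdeal (A : Matrix ι κ R) (k : ℕ) : Ideal R :=
  Ideal.span {a | ∃ (s : Fin k → ι) (t : Fin k → κ), a = (A.submatrix s t).det}

lemma det_submatrix_mem_minorIdeal (A : Matrix ι κ R) {k : ℕ} (s : Fin k → ι) (t : Fin k → κ) :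
    (A.submatrix s t).det ∈ A.minorIdeal k :=
  Ideal.subset_span ⟨s, t, rfl⟩

lemma minorIdeal_le_iff {A : Matrix ι κ R} {k : ℕ} {J : Ideal R} :
    A.minorIdeal k ≤ J ↔ ∀ (s : Fin k → ι) (t : Fin k → κ), (A.submatrix s t).det ∈ J := by
  rw [minorIdeal, Ideal.span_le]
  exact ⟨fun h s t => h ⟨s, t, rfl⟩, by rintro h _ ⟨s, t, rfl⟩; exact h s t⟩

lemma minorIdeal_map (A : Matrix ι κ R) (k : ℕ) (f : R →+* S) :
    (A.map f).minorIdeal k = (A.minorIdeal k).map f := by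
  refine le_antisymm (minorIdeal_le_iff.2 fun s t => ?_)
    (Ideal.map_le_iff_le_comap.2 (minorIdeal_le_iff.2 fun s t => ?_))
  · rw [submatrix_map, ← RingHom.mapMatrix_apply, ← RingHom.map_det]
    exact Ideal.mem_map_of_mem _ (det_submatrix_mem_minorIdeal A s t)
  · rw [Ideal.mem_comap, RingHom.map_det, RingHom.mapMatrix_apply, ← submatrix_map]
    exact det_submatrix_mem_minorIdeal _ s t

lemma minorIdeal_transpose (A : Matrix ι κ R) (k : ℕ) : Aᵀ.minorIdeal k = A.minorIdeal k := by
  refine le_antisymm (minorIdeal_le_iff.2 fun s t => ?_) (minorIdeal_le_iff.2 fun s t => ?_)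
  · rw [← transpose_submatrix, det_transpose]
    exact det_submatrix_mem_minorIdeal _ _ _
  · rw [← det_transpose, transpose_submatrix]
    exact det_submatrix_mem_minorIdeal _ _ _

/-- The rows of `P * A` are combinations of the rows of `A`, so multilinearity of the determinant
suffices. The row selections that arise may repeat indices, which `minorIdeal` permits. -/
lemma minorIdeal_mul_le_right [Fintype ι] (P : Matrix μ ι R) (A : Matrix ι κ R) (k : ℕ) :
    (P * A).minorIdeal k ≤ A.minorIdeal k := by
  classical
  refine minorIdeal_le_iff.2 fun s t => ?_
  have : (P * A).submatrix s t = fun i => ∑ j, P (s i) j • (A.submatrix id t) j := by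
    ext i j
    simp [mul_apply]
  rw [this]
  change detRowAlternating.toMultilinearMap _ ∈ _
  rw [MultilinearMap.map_sum]
  refine Ideal.sum_mem _ fun r _ => ?_
  rw [MultilinearMap.map_smul_univ]
  exact Ideal.mul_mem_left _ _ (det_submatrix_mem_minorIdeal A r t)

lemma minorIdeal_mul_le_left [Fintype κ] (A : Matrix ι κ R) (P : Matrix κ μ R) (k : ℕ) :
    (A * P).minorIdeal k ≤ A.minorIdeal k := by
  rw [← minorIdeal_transpose, transpose_mul, ← minorIdeal_transpose A]
  exact minorIdeal_mul_le_right _ _ _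

lemma exists_finset_card_eq_of_rank {σ : Type*} [Fintype σ] (rank : σ → ℕ) {k : ℕ}
    (hk : k ≤ Fintype.card σ) :
    ∃ T : Finset σ, T.card = k ∧ ∀ x ∈ T, ∀ y ∉ T, rank x ≤ rank y := by
  classical
  induction k with
  | zero => exact ⟨∅, by simp⟩
  | succ k ih =>
    obtain ⟨T, hT, h⟩ := ih (by omega)
    have hne : (Tᶜ).Nonempty := by
      rw [← Finset.card_pos, Finset.card_compl]; omega
    obtain ⟨z, hz, hmin⟩ := Finset.exists_min_image Tᶜ rank hne
    rw [Finset.mem_compl] at hz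
    refine ⟨insert z T, by rw [Finset.card_insert_of_notMem hz, hT], fun x hx y hy => ?_⟩
    rw [Finset.mem_insert, not_or] at hy
    rcases Finset.mem_insert.1 hx with rfl | hx
    · exact hmin y (Finset.mem_compl.2 hy.2)
    · exact h x hx y hy.2

/-- After the common factors are split off, any bijection from `T \ T'` to `T' \ T` pairs an element
of `T` with one outside `T`, hence of at least the same rank, so divisibility holds factor by
factor. -/
lemma prod_dvd_prod_of_rank {σ : Type*} {rank : σ → ℕ} {p : σ → R}
    (hp : ∀ x y, rank x ≤ rank y → p x ∣ p y) {T T' : Finset σ} (hT : T.card = T'.card)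
    (h : ∀ x ∈ T, ∀ y ∉ T, rank x ≤ rank y) : ∏ x ∈ T, p x ∣ ∏ x ∈ T', p x := by
  classical
  rw [← Finset.prod_inter_mul_prod_sdiff T T', ← Finset.prod_inter_mul_prod_sdiff T' T,
    Finset.inter_comm]
  refine mul_dvd_mul_left _ ?_
  have hc : (T \ T').card = (T' \ T).card := Finset.card_sdiff_comm hT
  let e := Finset.equivOfCardEq hc
  rw [← Finset.prod_coe_sort (T \ T'), ← Finset.prod_coe_sort (T' \ T), ← e.prod_comp]
  refine Finset.prod_dvd_prod_of_dvd _ _ fun x _ => hp _ _ (h _ ?_ _ ?_)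
  · exact (Finset.mem_sdiff.1 x.2).1
  · exact (Finset.mem_sdiff.1 (e x).2).2

section Diagonal

variable {α β σ : Type*} [DecidableEq σ] (p : σ → R)

/-- The rectangular diagonal matrix with entries `p`, extended by zero. -/
abbrev diagonalBlock (β α : Type*) (p : σ → R) : Matrix (β ⊕ σ) (α ⊕ σ) R :=
  fromBlocks 0 0 0 (diagonal p)

lemma prod_mem_minorIdeal_diagonalBlock (T : Finset σ) :
    ∏ x ∈ T, p x ∈ (diagonalBlock β α p).minorIdeal T.card := by
  let e := T.equivFin.symm
  have h := det_submatrix_mem_minorIdeal (diagonalBlock β α p)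
    (fun i => Sum.inr (e i : σ)) (fun i => Sum.inr (e i : σ))
  have : (diagonalBlock β α p).submatrix (fun i => Sum.inr (e i : σ)) (fun i => Sum.inr (e i : σ)) =
      diagonal fun i => p (e i) := by
    ext i j
    simp [diagonal_apply, Subtype.ext_iff.symm]
  rwa [this, det_diagonal, e.prod_comp (fun x : T => p x), Finset.prod_coe_sort] at h

/-- In the Leibniz expansion, a term without zero factors is, up to sign, a product of diagonal
entries, and these are at distinct positions because the columns are distinct. -/
lemma minorIdeal_diagonalBlock_le {J : Ideal R} {k : ℕ}
    (h : ∀ T : Finset σ, T.card = k → ∏ x ∈ T, p x ∈ J) :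
    (diagonalBlock β α p).minorIdeal k ≤ J := by
  refine minorIdeal_le_iff.2 fun s t => ?_
  by_cases ht : Function.Injective t
  swap
  · obtain ⟨i, j, hij, hne⟩ : ∃ i j, t i = t j ∧ i ≠ j := by
      simpa [Function.Injective] using ht
    rw [det_zero_of_column_eq hne fun x => by simp [hij]]
    exact J.zero_mem
  rw [det_apply]
  refine Ideal.sum_mem _ fun w _ => ?_
  rw [Units.smul_def, zsmul_eq_mul]
  refine Ideal.mul_mem_left _ _ ?_
  by_cases hz : ∃ i, diagonalBlock β α p (s (w i)) (t i) = 0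
  · obtain ⟨i, hi⟩ := hz
    rw [Finset.prod_eq_zero (Finset.mem_univ i) (by simpa using hi)]
    exact J.zero_mem
  push Not at hz
  have hx (i) : ∃ x : σ, t i = Sum.inr x ∧ diagonalBlock β α p (s (w i)) (t i) = p x := by
    have := hz i
    revert this
    rcases s (w i) with b | y <;> rcases t i with a | x <;> simp [diagonal_apply]
    rintro rfl _
    simp
  choose x hx hx' using hx
  have hinj : Function.Injective x := fun i j hij => ht (by rw [hx, hx, hij])
  have := h (Finset.univ.map ⟨x, hinj⟩) (by simp)
  simpa [hx'] using this

/-- If the diagonal entries form a divisibility chain and the `m × m` minors do not all lie in a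
single associated prime, then for `k ≤ m` the ideal of `k × k` minors is generated by a
nonzerodivisor. -/
lemma exists_minorIdeal_diagonalBlock_eq_span [Finite σ] [IsNoetherianRing R] {rank : σ → ℕ}
    (hp : ∀ x y, rank x ≤ rank y → p x ∣ p y) {k m : ℕ} (hk : k ≤ m)
    (hm : ∀ P ∈ associatedPrimes R R, ¬ (diagonalBlock β α p).minorIdeal m ≤ P) :
    ∃ q ∈ nonZeroDivisors R, (diagonalBlock β α p).minorIdeal k = Ideal.span {q} := by
  cases nonempty_fintype σ
  -- The zero ring has no associated primes, so nothing bounds `k` by the number of entries there;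
  -- but then any two ideals agree.
  cases subsingleton_or_nontrivial R
  · refine ⟨1, one_mem _, Subsingleton.elim _ _⟩
  have key : ∀ P ∈ associatedPrimes R R, ∃ T : Finset σ, T.card = m ∧ ∏ x ∈ T, p x ∉ P := by
    intro P hP
    by_contra! h
    exact hm P hP (minorIdeal_diagonalBlock_le p h)
  have hcard : k ≤ Fintype.card σ := by
    obtain ⟨P, hP⟩ := associatedPrimes.nonempty R R
    obtain ⟨T, hT, -⟩ := key P hP
    exact hk.trans (hT ▸ T.card_le_univ)
  obtain ⟨T₀, hT₀, hmin⟩ := exists_finset_card_eq_of_rank rank hcard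
  refine ⟨∏ x ∈ T₀, p x, ?_, le_antisymm (minorIdeal_diagonalBlock_le p fun T hT => ?_) ?_⟩
  -- Zerodivisors form the union of the associated primes. If `P` contained the product over `T₀`,
  -- it would contain the product over every `T` with `m` elements, since such a `T` has a subset
  -- with `k` elements.
  · rw [← SetLike.mem_coe, ← Set.notMem_compl_iff,
      ← biUnion_associatedPrimes_eq_compl_nonZeroDivisors R, Set.mem_iUnion₂]
    rintro ⟨P, hP, h⟩
    obtain ⟨T, hT, hTP⟩ := key P hP
    obtain ⟨T', hT', hc⟩ := Finset.exists_subset_card_eq (hT.symm ▸ hk : k ≤ T.card)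
    exact hTP (Ideal.mem_of_dvd _
      ((prod_dvd_prod_of_rank hp (hT₀.trans hc.symm) hmin).trans
        (Finset.prod_dvd_prod_of_subset _ _ _ hT')) h)
  · exact Ideal.mem_span_singleton.2 (prod_dvd_prod_of_rank hp (hT₀.trans hT.symm) hmin)
  · rw [Ideal.span_singleton_le_iff_mem, ← hT₀]
    exact prod_mem_minorIdeal_diagonalBlock p T₀

end Diagonal

end Matrix

/-! ### Frames, matrix representations and change of frame -/

namespace AlgebraicGeometry.Scheme.Modules

variable {X Z : Scheme.{u}} {E F M N : X.Modules}

/-- Construct a morphism of modules from compatible linear maps on sections. -/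
def homOfLinearMaps (l : ∀ U : X.Opens, Γ(M, U) →ₗ[Γ(X, U)] Γ(N, U))
    (hl : ∀ (U V : X.Opens) (i : U ⟶ V) (s : Γ(M, V)),
      l U (M.presheaf.map i.op s) = N.presheaf.map i.op (l V s)) : M ⟶ N :=
  ⟨{ app U := ModuleCat.ofHom (l U.unop)
     naturality {U V} i := by
      ext s
      exact hl V.unop U.unop i.unop s }⟩

@[simp]
lemma homOfLinearMaps_app (l : ∀ U : X.Opens, Γ(M, U) →ₗ[Γ(X, U)] Γ(N, U)) (hl) (U : X.Opens)
    (s : Γ(M, U)) : (homOfLinearMaps l hl).app U s = l U s := rfl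

lemma app_map (α : M ⟶ N) {U V : X.Opens} (i : U ⟶ V) (s : Γ(M, V)) :
    α.app U (M.presheaf.map i.op s) = N.presheaf.map i.op (α.app V s) :=
  congr($(α.mapPresheaf.naturality i.op) s)

lemma presheaf_map_map {U V W : X.Opens} (i : U ⟶ V) (j : V ⟶ W) (s : Γ(M, W)) :
    M.presheaf.map i.op (M.presheaf.map j.op s) = M.presheaf.map (i ≫ j).op s := by
  rw [op_comp, Functor.map_comp]; rfl

variable {ι ι' κ κ' : Type} [Finite ι] [Finite ι'] [Finite κ] [Finite κ'] {U V : X.Opens}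

lemma IsFrame.restrict {e : ι → Γ(E, U)} (he : IsFrame E U e) (h : V ≤ U) :
    IsFrame E V fun i => E.presheaf.map (homOfLE h).op (e i) := by
  intro W hW
  simp only [presheaf_map_map]
  exact he W (hW.trans h)

lemma IsFrame.linearIndependent {e : ι → Γ(E, U)} (he : IsFrame E U e) :
    LinearIndependent Γ(X, U) e := by
  have := (he U le_rfl).1
  simpa using this

lemma IsFrame.span_eq_top {e : ι → Γ(E, U)} (he : IsFrame E U e) :
    Submodule.span Γ(X, U) (Set.range e) = ⊤ := by
  have := (he U le_rfl).2
  simpa using this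

end AlgebraicGeometry.Scheme.Modules

namespace AlgebraicGeometry.Scheme.Modules

variable {X Z : Scheme.{u}} {E F M N : X.Modules}
variable {ι ι' κ κ' : Type} {U V : X.Opens}

/-- The matrix `A` represents `φ` with respect to the families `e` and `h` of sections. -/
def IsMatrixOf (φ : E ⟶ F) [Fintype κ] (e : ι → Γ(E, U)) (h : κ → Γ(F, U))
    (A : Matrix κ ι Γ(X, U)) : Prop :=
  ∀ j, φ.app U (e j) = ∑ i, A i j • h i

lemma IsMatrixOf.restrict {φ : E ⟶ F} [Fintype κ] {e : ι → Γ(E, U)} {h : κ → Γ(F, U)}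
    {A : Matrix κ ι Γ(X, U)} (hA : IsMatrixOf φ e h A) (hV : V ≤ U) :
    IsMatrixOf φ (fun i => E.presheaf.map (homOfLE hV).op (e i))
      (fun i => F.presheaf.map (homOfLE hV).op (h i))
      (A.map (X.presheaf.map (homOfLE hV).op).hom) := by
  intro j
  rw [app_map, hA j, map_sum]
  exact Finset.sum_congr rfl fun i _ => map_smul _ _ _ _

lemma IsFrame.exists_coeff [Finite ι] {e : ι → Γ(E, U)} (he : IsFrame E U e) [Fintype ι] (s : Γ(E, U)) :
    ∃ c : ι → Γ(X, U), s = ∑ i, c i • e i := by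
  have : s ∈ Submodule.span Γ(X, U) (Set.range e) := he.span_eq_top ▸ Submodule.mem_top
  obtain ⟨c, hc⟩ := (Submodule.mem_span_range_iff_exists_fun _).1 this
  exact ⟨c, hc.symm⟩

lemma IsFrame.exists_isMatrixOf [Finite κ] {h : κ → Γ(F, U)} (hh : IsFrame F U h) [Fintype κ] (φ : E ⟶ F)
    (e : ι → Γ(E, U)) : ∃ A, IsMatrixOf φ e h A := by
  choose c hc using fun j => hh.exists_coeff (φ.app U (e j))
  exact ⟨.of fun i j => c j i, hc⟩

/-- A change of frames gives `A' = Q * A * P`, by uniqueness of coordinates with respect to `h'`,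
and multiplication can only shrink the ideal of minors. -/
lemma IsMatrixOf.minorIdeal_le [Finite ι] {φ : E ⟶ F} [Fintype κ] [Fintype κ']
    {e : ι → Γ(E, U)} {h : κ → Γ(F, U)} {A : Matrix κ ι Γ(X, U)}
    {e' : ι' → Γ(E, U)} {h' : κ' → Γ(F, U)} {A' : Matrix κ' ι' Γ(X, U)}
    (hA : IsMatrixOf φ e h A) (hA' : IsMatrixOf φ e' h' A')
    (he : IsFrame E U e) (hh' : IsFrame F U h') (k : ℕ) : A'.minorIdeal k ≤ A.minorIdeal k := by
  cases nonempty_fintype ι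
  choose P hP using fun j => he.exists_coeff (e' j)
  choose Q hQ using fun j => hh'.exists_coeff (h j)
  have : A' = (Matrix.of fun i j => Q j i) * A * (Matrix.of fun i j => P j i) := by
    ext i j
    have key : ∑ i, A' i j • h' i =
        ∑ i, ((Matrix.of fun i j => Q j i) * A * (Matrix.of fun i j => P j i)) i j • h' i := by
      calc _ = φ.app U (e' j) := (hA' j).symm
        _ = ∑ x, ∑ k, ∑ i, (P j x * (A k x * Q k i)) • h' i := by
          rw [hP j, map_sum]
          refine Finset.sum_congr rfl fun x _ => ?_
          rw [Hom.app_smul, hA x, Finset.smul_sum]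
          refine Finset.sum_congr rfl fun k _ => ?_
          conv_lhs => rw [hQ k]
          simp only [Finset.smul_sum, smul_smul]
        _ = _ := by
          simp only [Matrix.mul_apply, Matrix.of_apply, Finset.sum_mul, Finset.sum_smul]
          rw [Finset.sum_comm_cycle]
          refine Finset.sum_congr rfl fun i _ => Finset.sum_congr rfl fun x _ =>
            Finset.sum_congr rfl fun k _ => ?_
          congr 1
          ring
    exact Fintype.linearIndependent_iffₛ.1 hh'.linearIndependent (fun i => A' i j) _ key i
  rw [this]
  exact (Matrix.minorIdeal_mul_le_left _ _ _).trans (Matrix.minorIdeal_mul_le_right _ _ _)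

lemma IsMatrixOf.minorIdeal_eq [Finite ι] [Finite ι'] {φ : E ⟶ F} [Fintype κ] [Fintype κ']
    {e : ι → Γ(E, U)} {h : κ → Γ(F, U)} {A : Matrix κ ι Γ(X, U)}
    {e' : ι' → Γ(E, U)} {h' : κ' → Γ(F, U)} {A' : Matrix κ' ι' Γ(X, U)}
    (hA : IsMatrixOf φ e h A) (hA' : IsMatrixOf φ e' h' A')
    (he : IsFrame E U e) (hh : IsFrame F U h) (he' : IsFrame E U e') (hh' : IsFrame F U h')
    (k : ℕ) : A.minorIdeal k = A'.minorIdeal k :=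
  (hA'.minorIdeal_le hA he' hh k).antisymm (hA.minorIdeal_le hA' he hh' k)

/-- The sections of `M` over an open set only depend on its intersection with `U`. -/
def IsLocalOn (M : X.Modules) (U : X.Opens) : Prop :=
  ∀ W : X.Opens, Function.Bijective (M.presheaf.map (homOfLE (inf_le_left : W ⊓ U ≤ W)).op)

lemma bijective_map_of_eq {U V : X.Opens} (h : U = V) :
    Function.Bijective (M.presheaf.map (homOfLE h.le).op) := by
  subst h
  have : M.presheaf.map (homOfLE (le_refl U)).op = 𝟙 _ := M.presheaf.map_id _
  rw [this]
  exact Function.bijective_id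

/-- Together with `IsFrame.exists_hom`: for `M` local on `U`, morphisms `E ⟶ M` correspond to
families of sections of `M` over `U`. This property characterizes frames and passes through the
pullback adjunction. -/
lemma IsFrame.hom_ext [Finite ι] {e : ι → Γ(E, U)} (he : IsFrame E U e) (hM : IsLocalOn M U) {α β : E ⟶ M}
    (h : ∀ i, α.app U (e i) = β.app U (e i)) : α = β := by
  cases nonempty_fintype ι
  ext W s
  refine (hM W).1 ?_
  rw [← app_map, ← app_map]
  obtain ⟨c, hc⟩ := (he.restrict (inf_le_right : W ⊓ U ≤ U)).exists_coeff
    (E.presheaf.map (homOfLE (inf_le_left : W ⊓ U ≤ W)).op s)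
  rw [hc, map_sum, map_sum]
  simp only [Hom.app_smul, app_map, h]

lemma IsFrame.exists_hom [Finite ι] {e : ι → Γ(E, U)} (he : IsFrame E U e) (hM : IsLocalOn M U)
    (n : ι → Γ(M, U)) : ∃ α : E ⟶ M, ∀ i, α.app U (e i) = n i := by
  cases nonempty_fintype ι
  let b (W : X.Opens) : Module.Basis ι Γ(X, W ⊓ U) Γ(E, W ⊓ U) :=
    .mk (he _ inf_le_right).1 (he _ inf_le_right).2.ge
  have hb (W : X.Opens) (i) : b W i = E.presheaf.map (homOfLE inf_le_right).op (e i) := by simp [b]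
  let c (W : X.Opens) : Γ(E, W ⊓ U) →ₗ[Γ(X, W ⊓ U)] Γ(M, W ⊓ U) :=
    (b W).constr ℕ fun i => M.presheaf.map (homOfLE inf_le_right).op (n i)
  have hc (W : X.Opens) (i) : c W (E.presheaf.map (homOfLE inf_le_right).op (e i)) =
      M.presheaf.map (homOfLE inf_le_right).op (n i) := by
    rw [← hb, Module.Basis.constr_basis]
  -- Sections of `M` over `W` are the same as sections over `W ⊓ U`, where `e` restricts to a basis;
  -- `g` is the inverse of restriction.
  choose g hg using fun W s => (hM W).2 s
  have hg' (W) (x y : Γ(M, W)) (h : M.presheaf.map (homOfLE (inf_le_left : W ⊓ U ≤ W)).op x = M.presheaf.map (homOfLE (inf_le_left : W ⊓ U ≤ W)).op y) : x = y := (hM W).1 h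
  let l (W : X.Opens) : Γ(E, W) →ₗ[Γ(X, W)] Γ(M, W) :=
    { toFun s := g W (c W (E.presheaf.map (homOfLE inf_le_left).op s))
      map_add' s t := hg' _ _ _ <| by simp [hg]
      map_smul' r s := hg' _ _ _ <| by simp [hg] }
  have hl (W : X.Opens) (s : Γ(E, W)) : M.presheaf.map (homOfLE inf_le_left).op (l W s) =
    c W (E.presheaf.map (homOfLE inf_le_left).op s) := hg W _
  have hcc {W W' : X.Opens} (i : W ⊓ U ⟶ W' ⊓ U) (s : Γ(E, W' ⊓ U)) :
      c W (E.presheaf.map i.op s) = M.presheaf.map i.op (c W' s) := by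
    obtain ⟨a, rfl⟩ := (he.restrict (inf_le_right : W' ⊓ U ≤ U)).exists_coeff s
    simp only [map_sum, map_smul, presheaf_map_map, hc, _root_.map_smul]
    exact Finset.sum_congr rfl fun x _ => congrArg _ (hc W x)
  refine ⟨homOfLinearMaps l fun W W' i s => hg' _ _ _ ?_, fun i => hg' _ _ _ ?_⟩
  · rw [hl, presheaf_map_map, presheaf_map_map]
    have := hcc (homOfLE (inf_le_inf_right U i.le)) (E.presheaf.map (homOfLE inf_le_left).op s)
    rw [← hl, presheaf_map_map, presheaf_map_map] at this
    exact this
  · rw [homOfLinearMaps_app, hl]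
    exact hc U i

end AlgebraicGeometry.Scheme.Modules

/-! ### Frames characterized by a universal property -/

namespace AlgebraicGeometry.Scheme.Modules

section Localization

variable {X : Scheme.{u}} {E : X.Modules} {U : X.Opens} {ι : Type}

/-- The extension to `X` of the restriction of `M` to `U`. -/
noncomputable def restrictExtend (M : X.Modules) (U : X.Opens) : X.Modules :=
  (pushforward U.ι).obj (M.restrict U.ι)

/-- The restriction map from `M` to `restrictExtend M U`. -/
noncomputable def toRestrictExtend (M : X.Modules) (U : X.Opens) : M ⟶ restrictExtend M U :=
  (restrictAdjunction U.ι).unit.app M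

lemma isLocalOn_restrictExtend (M : X.Modules) (U : X.Opens) : IsLocalOn (restrictExtend M U) U := by
  intro W
  have h : U.ι ''ᵁ U.ι ⁻¹ᵁ (W ⊓ U) = U.ι ''ᵁ U.ι ⁻¹ᵁ W := by
    simp only [Scheme.Hom.image_preimage_eq_opensRange_inf, Scheme.Opens.opensRange_ι]
    exact le_antisymm (inf_le_inf_left _ inf_le_left)
      (le_inf inf_le_left (le_inf inf_le_right inf_le_left))
  exact bijective_map_of_eq (M := M) h

lemma toRestrictExtend_bijective (M : X.Modules) {U W : X.Opens} (hW : W ≤ U) :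
    Function.Bijective ((toRestrictExtend M U).app W) := by
  have h : U.ι ''ᵁ U.ι ⁻¹ᵁ W = W := by
    simpa only [Scheme.Hom.image_preimage_eq_opensRange_inf, Scheme.Opens.opensRange_ι, inf_eq_right]
      using hW
  exact bijective_map_of_eq (M := M) h

/-- The structure sheaf as a module over itself. -/
noncomputable def structureSheaf (X : Scheme.{u}) : X.Modules := SheafOfModules.unit X.ringCatSheaf

/-- The identification of the sections of `structureSheaf X` with functions. -/
def structureSheafEquiv (X : Scheme.{u}) (U : X.Opens) :
    Γ(X, U) ≃ₗ[Γ(X, U)] Γ(structureSheaf X, U) := LinearEquiv.refl _ _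

lemma structureSheafEquiv_map {U V : X.Opens} (i : U ⟶ V) (r : Γ(X, V)) :
    (structureSheaf X).presheaf.map i.op (structureSheafEquiv X V r) =
      structureSheafEquiv X U (X.presheaf.map i.op r) := rfl

lemma isFrame_of_coeff [Fintype ι] {e : ι → Γ(E, U)}
    (h : ∀ (V : X.Opens) (hV : V ≤ U) (s : Γ(E, V)), ∃ c : ι → Γ(X, V),
      s = ∑ i, c i • E.presheaf.map (homOfLE hV).op (e i))
    (h' : ∀ (V : X.Opens) (hV : V ≤ U) (c : ι → Γ(X, V)),
      ∑ i, c i • E.presheaf.map (homOfLE hV).op (e i) = 0 → ∀ i, c i = 0) : IsFrame E U e := by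
  refine fun V hV => ⟨Fintype.linearIndependent_iff.2 (h' V hV), eq_top_iff.2 fun s _ => ?_⟩
  obtain ⟨c, hc⟩ := h V hV s
  exact (Submodule.mem_span_range_iff_exists_fun _).2 ⟨c, hc.symm⟩

/-- The generator of the extension to `X` of the structure sheaf of `U`. -/
noncomputable def restrictExtendOne (U : X.Opens) : Γ(restrictExtend (structureSheaf X) U, U) :=
  (toRestrictExtend (structureSheaf X) U).app U (structureSheafEquiv X U 1)

lemma smul_map_restrictExtendOne {U V : X.Opens} (hV : V ≤ U) (r : Γ(X, V)) :
    r • (restrictExtend (structureSheaf X) U).presheaf.map (homOfLE hV).op (restrictExtendOne U) =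
      (toRestrictExtend (structureSheaf X) U).app V (structureSheafEquiv X V r) := by
  rw [restrictExtendOne, ← app_map, structureSheafEquiv_map, map_one, ← Hom.app_smul,
    ← _root_.map_smul, smul_eq_mul, mul_one]

lemma exists_smul_map_restrictExtendOne {U V : X.Opens} (hV : V ≤ U)
    (s : Γ(restrictExtend (structureSheaf X) U, V)) : ∃ r : Γ(X, V),
      r • (restrictExtend (structureSheaf X) U).presheaf.map (homOfLE hV).op
        (restrictExtendOne U) = s := by
  obtain ⟨r, hr⟩ := (toRestrictExtend_bijective (structureSheaf X) hV).2 s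
  refine ⟨(structureSheafEquiv X V).symm r, ?_⟩
  rw [smul_map_restrictExtendOne]
  exact hr

lemma eq_zero_of_smul_map_restrictExtendOne {U V : X.Opens} (hV : V ≤ U) {r : Γ(X, V)}
    (h : r • (restrictExtend (structureSheaf X) U).presheaf.map (homOfLE hV).op
      (restrictExtendOne U) = 0) : r = 0 := by
  rw [smul_map_restrictExtendOne] at h
  exact (toRestrictExtend_bijective (structureSheaf X) hV).1 (h.trans (map_zero _).symm)

lemma isFrame_restrictExtendOne (U : X.Opens) :
    IsFrame (restrictExtend (structureSheaf X) U) U fun _ : Unit => restrictExtendOne U := by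
  refine isFrame_of_coeff (fun V hV s => ?_) fun V hV c hc i => ?_
  · obtain ⟨r, hr⟩ := exists_smul_map_restrictExtendOne hV s
    exact ⟨fun _ => r, by rw [Fintype.sum_unique, hr]⟩
  · rw [Fintype.sum_unique] at hc
    exact eq_zero_of_smul_map_restrictExtendOne hV hc

lemma sum_app_apply {M N : X.Modules} [Fintype ι] (α : ι → (M ⟶ N)) (V : X.Opens) (s : Γ(M, V)) :
    (∑ i, α i).app V s = ∑ i, (α i).app V s := by
  classical
  induction (Finset.univ : Finset ι) using Finset.induction_on with
  | empty => simp
  | insert i t hi ih => rw [Finset.sum_insert hi, Finset.sum_insert hi, ← ih]; rfl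

/-- The test modules are the extensions to `X` of the structure sheaf of `U` and of `E` restricted
to `U`. The first provides coordinate maps `π i`; uniqueness of maps to the second shows that
sections are recovered from their coordinates. -/
lemma isFrame_of_existsUnique_hom [Finite ι] {e : ι → Γ(E, U)}
    (h : ∀ (M : X.Modules), IsLocalOn M U → ∀ n : ι → Γ(M, U),
      ∃! α : E ⟶ M, ∀ i, α.app U (e i) = n i) :
    IsFrame E U e := by
  classical
  cases nonempty_fintype ι
  have h1 := isLocalOn_restrictExtend (structureSheaf X) U
  have h2 := isLocalOn_restrictExtend E U
  choose π hπ _ using fun i => h _ h1 fun j => if j = i then restrictExtendOne U else 0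
  choose σ hσ using fun i => (isFrame_restrictExtendOne U).exists_hom h2
    fun _ => (toRestrictExtend E U).app U (e i)
  -- `σ i` sends the generator to `e i`, so both sides agree on the family `e`.
  have key : toRestrictExtend E U = ∑ i, π i ≫ σ i := by
    refine (h _ h2 fun i => (toRestrictExtend E U).app U (e i)).unique (fun _ => rfl) fun j => ?_
    rw [sum_app_apply, Finset.sum_eq_single j]
    · rw [Hom.comp_app, AddCommGrpCat.comp_apply, hπ, if_pos rfl]
      exact hσ j ()
    · intro i _ hij
      rw [Hom.comp_app, AddCommGrpCat.comp_apply, hπ, if_neg hij.symm, map_zero]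
    · simp
  refine isFrame_of_coeff (fun V hV s => ?_) fun V hV c hc i => ?_
  · choose r hr using fun i => exists_smul_map_restrictExtendOne hV ((π i).app V s)
    refine ⟨r, (toRestrictExtend_bijective E hV).1 ?_⟩
    rw [map_sum]
    conv_lhs => rw [key]
    rw [sum_app_apply]
    refine Finset.sum_congr rfl fun i _ => ?_
    rw [Hom.comp_app, AddCommGrpCat.comp_apply, ← hr i, Hom.app_smul, Hom.app_smul, app_map, app_map, hσ i ()]
  · have := congr((π i).app V $hc)
    rw [map_sum, map_zero, Finset.sum_eq_single i] at this
    · rw [Hom.app_smul, app_map, hπ, if_pos rfl] at this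
      exact eq_zero_of_smul_map_restrictExtendOne hV this
    · intro j _ hij
      rw [Hom.app_smul, app_map, hπ, if_neg hij, map_zero, smul_zero]
    · simp

end Localization

/-! ### Pullback of sections, frames and matrices -/

section Pullback

variable {X Z : Scheme.{u}} {E F : X.Modules} (f : Z ⟶ X) {U V : X.Opens} {ι κ : Type}

/-- The pullback of a section of `E` to a section of the pullback of `E`. -/
noncomputable def pullbackSection (s : Γ(E, U)) : Γ((pullback f).obj E, f ⁻¹ᵁ U) :=
  ((pullbackPushforwardAdjunction f).unit.app E).app U s

lemma pullbackSection_sum_smul [Fintype ι] (c : ι → Γ(X, U)) (s : ι → Γ(E, U)) :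
    pullbackSection f (∑ i, c i • s i) = ∑ i, f.app U (c i) • pullbackSection f (s i) := by
  rw [pullbackSection, map_sum]
  exact Finset.sum_congr rfl fun i _ => Hom.app_smul _ _ _

lemma pullback_map_app_pullbackSection (φ : E ⟶ F) (s : Γ(E, U)) :
    ((pullback f).map φ).app (f ⁻¹ᵁ U) (pullbackSection f s) = pullbackSection f (φ.app U s) := by
  have := (pullbackPushforwardAdjunction f).unit.naturality φ
  exact congr(($this).app U s).symm

lemma IsLocalOn.pushforward {M : Z.Modules} (hM : IsLocalOn M (f ⁻¹ᵁ U)) :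
    IsLocalOn ((pushforward f).obj M) U := fun W => hM (f ⁻¹ᵁ W)

/-- The universal property of frames is transported along the adjunction between pullback and
pushforward, because pushforward turns modules local on `f ⁻¹ᵁ U` into modules local on `U`. No
explicit description of the pullback sheaf is needed. -/
lemma IsFrame.pullback [Finite ι] {e : ι → Γ(E, U)} (he : IsFrame E U e) :
    IsFrame ((pullback f).obj E) (f ⁻¹ᵁ U) fun i => pullbackSection f (e i) := by
  refine isFrame_of_existsUnique_hom fun M hM n => ?_
  let H := (pullbackPushforwardAdjunction f).homEquiv E M
  have hH (α) (i) : (H α).app U (e i) = α.app (f ⁻¹ᵁ U) (pullbackSection f (e i)) := by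
    rw [Adjunction.homEquiv_unit]
    rfl
  obtain ⟨β, hβ⟩ := he.exists_hom (hM.pushforward f) n
  refine ⟨H.symm β, fun i => ?_, fun α hα => H.injective ?_⟩
  · rw [← hH, Equiv.apply_symm_apply, hβ]
  · refine he.hom_ext (hM.pushforward f) fun i => ?_
    rw [hH, hα, Equiv.apply_symm_apply, hβ]

lemma IsMatrixOf.pullback [Fintype κ] {φ : E ⟶ F} {e : ι → Γ(E, U)} {h : κ → Γ(F, U)}
    {A : Matrix κ ι Γ(X, U)} (hA : IsMatrixOf φ e h A) :
    IsMatrixOf ((pullback f).map φ) (fun i => pullbackSection f (e i))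
      (fun i => pullbackSection f (h i)) (A.map (f.app U).hom) := by
  intro j
  rw [pullback_map_app_pullbackSection, hA j, pullbackSection_sum_smul]
  rfl

lemma IsLocallyFreeOfFiniteRank.pullback (hE : IsLocallyFreeOfFiniteRank E) :
    IsLocallyFreeOfFiniteRank ((pullback f).obj E) := by
  intro z
  obtain ⟨U, n, e, hx, he⟩ := hE (f z)
  exact ⟨f ⁻¹ᵁ U, n, _, hx, he.pullback f⟩

end Pullback

end AlgebraicGeometry.Scheme.Modules

/-! ### Quasi-coherent ideal sheaves with prescribed stalks -/

namespace AlgebraicGeometry.Scheme.IdealSheafData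

variable {X : Scheme.{u}}

lemma map_germ_res {U V : X.Opens} (h : V ≤ U) (J : Ideal Γ(X, U)) {x : X} (hx : x ∈ V) :
    (J.map (X.presheaf.map (homOfLE h).op).hom).map (X.presheaf.germ V x hx).hom =
      J.map (X.presheaf.germ U x (h hx)).hom := by
  rw [Ideal.map_map, ← CommRingCat.hom_comp, X.presheaf.germ_res]

/-- The sections of the ideal sheaf with stalks `D` over `V`. -/
noncomputable def stalkwiseIdeal (D : ∀ x : X, Ideal (X.presheaf.stalk x)) (V : X.Opens) : Ideal Γ(X, V) :=
  ⨅ x : V, (D x).comap (X.presheaf.germ V x.1 x.2).hom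

lemma mem_stalkwiseIdeal {D : ∀ x : X, Ideal (X.presheaf.stalk x)} {V : X.Opens} {a : Γ(X, V)} :
    a ∈ stalkwiseIdeal D V ↔ ∀ (x : X) (hx : x ∈ V), X.presheaf.germ V x hx a ∈ D x := by
  simp [stalkwiseIdeal]

variable {D : ∀ x : X, Ideal (X.presheaf.stalk x)}

/-- Membership in an ideal over the affine `X.basicOpen g` can be tested on stalks. So `b` lies in
the localized ideal; one power of `g` clears the denominator and another the kernel of localization.
-/
lemma exists_pow_mul_mem_of_affine {W : X.Opens} (hW : IsAffineOpen W) {J : Ideal Γ(X, W)}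
    (hJ : ∀ (x : X) (hx : x ∈ W), D x = J.map (X.presheaf.germ W x hx).hom) (g b : Γ(X, W))
    (hb : ∀ (x : X) (hx : x ∈ W), x ∈ X.basicOpen g → X.presheaf.germ W x hx b ∈ D x) :
    ∃ k, g ^ k * b ∈ J := by
  have := hW.isLocalization_basicOpen g
  have h1 : algebraMap Γ(X, W) Γ(X, X.basicOpen g) b ∈
      J.map (algebraMap Γ(X, W) Γ(X, X.basicOpen g)) := by
    refine (hW.basicOpen g).mem_ideal_iff.2 fun x hx => ?_
    have h2 := map_germ_res (X.basicOpen_le g) J hx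
    have h3 := hb x (X.basicOpen_le g hx) hx
    rw [hJ x (X.basicOpen_le g hx), ← h2, ← X.presheaf.germ_res_apply (homOfLE (X.basicOpen_le g)) x hx b] at h3
    exact h3
  obtain ⟨⟨j, ⟨_, k, rfl⟩⟩, hj⟩ := (IsLocalization.mem_map_algebraMap_iff (.powers g) _).1 h1
  rw [← map_mul] at hj
  obtain ⟨⟨_, l, rfl⟩, hl⟩ := (IsLocalization.eq_iff_exists (.powers g) _).1 hj
  refine ⟨l + k, ?_⟩
  have : g ^ (l + k) * b = g ^ l * j := by rw [← hl]; ring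
  rw [this]
  exact J.mul_mem_left _ j.2

/-- This is quasi-coherence. A section over `X.basicOpen g` is a fraction `b / g ^ n`, and `b` must
be multiplied by a power of `g` to satisfy the stalk conditions on all of `V`. Such powers exist
locally because `D` locally comes from an ideal of sections, and quasi-compactness gives a common
one. -/
lemma map_stalkwiseIdeal (hD : ∀ x : X, ∃ (U : X.Opens) (J : Ideal Γ(X, U)), x ∈ U ∧
      ∀ (y : X) (hy : y ∈ U), D y = J.map (X.presheaf.germ U y hy).hom)
    {V : X.Opens} (hV : IsAffineOpen V) (g : Γ(X, V)) :
    (stalkwiseIdeal D V).map (X.presheaf.map (homOfLE (X.basicOpen_le g)).op).hom =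
      stalkwiseIdeal D (X.basicOpen g) := by
  refine le_antisymm (Ideal.map_le_iff_le_comap.2 fun a ha => ?_) fun a ha => ?_
  · rw [Ideal.mem_comap, mem_stalkwiseIdeal]
    intro x hx
    have := mem_stalkwiseIdeal.1 ha x (X.basicOpen_le g hx)
    rwa [← X.presheaf.germ_res_apply (homOfLE (X.basicOpen_le g)) x hx a] at this
  have := hV.isLocalization_basicOpen g
  obtain ⟨⟨b, ⟨_, n, rfl⟩⟩, hb⟩ := IsLocalization.surj (.powers g) a
  have hb' (x : X) (hx : x ∈ V) (hxg : x ∈ X.basicOpen g) : X.presheaf.germ V x hx b ∈ D x := by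
    have h1 : X.presheaf.germ V x hx b = X.presheaf.germ (X.basicOpen g) x hxg
      (algebraMap Γ(X, V) Γ(X, X.basicOpen g) b) :=
        (X.presheaf.germ_res_apply (homOfLE (X.basicOpen_le g)) x hxg b).symm
    rw [h1, ← hb, map_mul]
    exact Ideal.mul_mem_right _ _ (mem_stalkwiseIdeal.1 ha x hxg)
  obtain ⟨N, hN⟩ : ∃ N, ∀ n ≥ N, ∀ x ∈ (V : Set X), ∀ (hx : x ∈ V),
      X.presheaf.germ V x hx (g ^ n * b) ∈ D x := by
    refine hV.isCompact.induction_on (p := fun S => ∃ N, ∀ n ≥ N, ∀ x ∈ S, ∀ (hx : x ∈ V),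
      X.presheaf.germ V x hx (g ^ n * b) ∈ D x) ⟨0, by simp⟩ ?_ ?_ ?_
    · rintro S T hST ⟨N, hN⟩
      exact ⟨N, fun n hn x hx => hN n hn x (hST hx)⟩
    · rintro S T ⟨N, hN⟩ ⟨N', hN'⟩
      refine ⟨max N N', fun n hn x hx => ?_⟩
      rcases hx with hx | hx
      · exact hN n (le_trans (le_max_left _ _) hn) x hx
      · exact hN' n (le_trans (le_max_right _ _) hn) x hx
    · intro x hx
      obtain ⟨U, J, hxU, hJ⟩ := hD x
      obtain ⟨_, ⟨W, hW, rfl⟩, hxW, hWU⟩ := X.isBasis_affineOpens.exists_subset_of_mem_open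
        (show x ∈ ((V ⊓ U : X.Opens) : Set X) from ⟨hx, hxU⟩) (V ⊓ U).isOpen
      replace hW : IsAffineOpen W := hW
      have hWV : W ≤ V := fun y hy => (hWU hy).1
      replace hWU : W ≤ U := fun y hy => (hWU hy).2
      let J' := J.map (X.presheaf.map (homOfLE hWU).op).hom
      have hJ' (y : X) (hy : y ∈ W) : D y = J'.map (X.presheaf.germ W y hy).hom := by
        rw [map_germ_res, hJ y (hWU hy)]
      obtain ⟨k, hk⟩ := exists_pow_mul_mem_of_affine hW hJ' (X.presheaf.map (homOfLE hWV).op g)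
        (X.presheaf.map (homOfLE hWV).op b) fun y hy hyg => by
          rw [X.presheaf.germ_res_apply]
          refine hb' y (hWV hy) ?_
          rw [basicOpen_res] at hyg
          exact hyg.2
      refine ⟨W, mem_nhdsWithin_of_mem_nhds (W.isOpen.mem_nhds hxW), k, fun n hn y hy hyV => ?_⟩
      rw [← Nat.sub_add_cancel hn, pow_add, mul_assoc, map_mul]
      refine Ideal.mul_mem_left _ _ ?_
      rw [hJ' y hy, ← X.presheaf.germ_res_apply (homOfLE hWV) y hy]
      refine Ideal.mem_map_of_mem _ ?_
      simpa using hk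
  -- From `a * g ^ n = b` it follows that `a * g ^ (N + n) = g ^ N * b`.
  refine (IsLocalization.mem_map_algebraMap_iff (.powers g) _).2
    ⟨⟨⟨g ^ N * b, mem_stalkwiseIdeal.2 fun x hx => hN N le_rfl x hx hx⟩, ⟨g ^ (N + n), N + n, rfl⟩⟩, ?_⟩
  simp only [map_mul, ← hb, map_pow]
  ring

/-- The quasi-coherent ideal sheaf with given stalks. -/
noncomputable def ofStalks (D : ∀ x : X, Ideal (X.presheaf.stalk x))
    (hD : ∀ x : X, ∃ (U : X.Opens) (J : Ideal Γ(X, U)), x ∈ U ∧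
      ∀ (y : X) (hy : y ∈ U), D y = J.map (X.presheaf.germ U y hy).hom) : X.IdealSheafData where
  ideal V := stalkwiseIdeal D V
  map_ideal_basicOpen V g := map_stalkwiseIdeal hD V.2 g

lemma stalkwiseIdeal_eq {U : X.Opens} (hU : IsAffineOpen U) {J : Ideal Γ(X, U)}
    (hJ : ∀ (y : X) (hy : y ∈ U), D y = J.map (X.presheaf.germ U y hy).hom) :
    stalkwiseIdeal D U = J := by
  ext a
  rw [mem_stalkwiseIdeal, hU.mem_ideal_iff]
  exact forall₂_congr fun x hx => by rw [hJ x hx]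

end AlgebraicGeometry.Scheme.IdealSheafData

/-! ### Determinantal ideals computed from one matrix -/

namespace AlgebraicGeometry.Scheme.Modules

variable {X : Scheme.{u}} {E F : X.Modules} {U V : X.Opens}

/-- `IsMinor` asks for distinct rows and columns while `minorIdeal` does not; the additional
determinants have a repeated row or column and vanish. -/
lemma isMinor_of_isMatrixOf {φ : E ⟶ F} {p q k : ℕ} {e : Fin p → Γ(E, U)} {h : Fin q → Γ(F, U)}
    {A : Matrix (Fin q) (Fin p) Γ(X, U)} (he : IsFrame E U e) (hh : IsFrame F U h)
    (hA : IsMatrixOf φ e h A) (s : Fin k → Fin q) (t : Fin k → Fin p) :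
    (A.submatrix s t).det = 0 ∨ IsMinor φ k U (A.submatrix s t).det := by
  by_cases hs : Function.Injective s
  swap
  · obtain ⟨i, j, hij, hne⟩ : ∃ i j, s i = s j ∧ i ≠ j := by
      simpa [Function.Injective] using hs
    exact Or.inl (Matrix.det_zero_of_row_eq hne (by ext x; simp [hij]))
  by_cases ht : Function.Injective t
  swap
  · obtain ⟨i, j, hij, hne⟩ : ∃ i j, t i = t j ∧ i ≠ j := by
      simpa [Function.Injective] using ht
    exact Or.inl (Matrix.det_zero_of_column_eq hne fun x => by simp [hij])
  exact Or.inr ⟨p, q, e, h, A, s, t, he, hh, hA, hs, ht, rfl⟩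

lemma IsMinor.exists_mem {φ : E ⟶ F} {k : ℕ} {a : Γ(X, U)} (ha : IsMinor φ k U a) :
    ∃ (p q : ℕ) (e : Fin p → Γ(E, U)) (h : Fin q → Γ(F, U)) (A : Matrix (Fin q) (Fin p) Γ(X, U)),
      IsFrame E U e ∧ IsFrame F U h ∧ IsMatrixOf φ e h A ∧ a ∈ A.minorIdeal k := by
  obtain ⟨p, q, e, h, A, s, t, he, hh, hA, -, -, rfl⟩ := ha
  exact ⟨p, q, e, h, A, he, hh, hA, A.det_submatrix_mem_minorIdeal s t⟩

/-- The ideal of the local ring at `x` generated by the `k × k` minors of `φ`. -/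
noncomputable def minorStalk (φ : E ⟶ F) (k : ℕ) (x : X) : Ideal (X.presheaf.stalk x) :=
  Ideal.span {g | ∃ (U : X.affineOpens) (hx : x ∈ U.1) (a : Γ(X, U)),
    IsMinor φ k U a ∧ g = X.presheaf.germ U.1 x hx a}

lemma minorStalk_eq {φ : E ⟶ F} {k p q : ℕ} {e : Fin p → Γ(E, U)} {h : Fin q → Γ(F, U)}
    {A : Matrix (Fin q) (Fin p) Γ(X, U)} (he : IsFrame E U e) (hh : IsFrame F U h)
    (hA : IsMatrixOf φ e h A) (x : X) (hx : x ∈ U) :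
    minorStalk φ k x = (A.minorIdeal k).map (X.presheaf.germ U x hx).hom := by
  refine le_antisymm (Ideal.span_le.2 ?_)
    (Ideal.map_le_iff_le_comap.2 (Matrix.minorIdeal_le_iff.2 fun s t => ?_))
  · rintro _ ⟨V, hxV, a, ha, rfl⟩
    obtain ⟨p', q', e', h', A', he', hh', hA', ha⟩ := ha.exists_mem
    have hW : x ∈ U ⊓ V.1 := ⟨hx, hxV⟩
    have key := (hA.restrict (inf_le_left : U ⊓ V.1 ≤ U)).minorIdeal_eq
      (hA'.restrict (inf_le_right : U ⊓ V.1 ≤ V.1)) (he.restrict _) (hh.restrict _)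
      (he'.restrict _) (hh'.restrict _) k
    rw [Matrix.minorIdeal_map, Matrix.minorIdeal_map] at key
    rw [← IdealSheafData.map_germ_res inf_le_left _ hW, key, IdealSheafData.map_germ_res]
    exact Ideal.mem_map_of_mem _ ha
  · obtain ⟨_, ⟨W, hW, rfl⟩, hxW, hWU⟩ := X.isBasis_affineOpens.exists_subset_of_mem_open
      (show x ∈ (U : Set X) from hx) U.isOpen
    replace hWU : W ≤ U := hWU
    rw [Ideal.mem_comap, ← X.presheaf.germ_res_apply (homOfLE hWU) x hxW]
    have h1 : X.presheaf.map (homOfLE hWU).op (A.submatrix s t).det =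
        ((A.map (X.presheaf.map (homOfLE hWU).op).hom).submatrix s t).det := by
      rw [Matrix.submatrix_map, ← RingHom.mapMatrix_apply, ← RingHom.map_det]
    rw [h1]
    rcases isMinor_of_isMatrixOf (he.restrict hWU) (hh.restrict hWU) (hA.restrict hWU) s t with h | h
    · rw [h, map_zero]
      exact Ideal.zero_mem _
    · exact Ideal.subset_span ⟨⟨W, hW⟩, hxW, _, h, rfl⟩

lemma exists_isMatrixOf (hE : IsLocallyFreeOfFiniteRank E) (hF : IsLocallyFreeOfFiniteRank F)
    (φ : E ⟶ F) (x : X) : ∃ (U : X.Opens) (p q : ℕ) (e : Fin p → Γ(E, U)) (h : Fin q → Γ(F, U))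
      (A : Matrix (Fin q) (Fin p) Γ(X, U)), x ∈ U ∧ IsFrame E U e ∧ IsFrame F U h ∧
      IsMatrixOf φ e h A := by
  obtain ⟨U, p, e, hxU, he⟩ := hE x
  obtain ⟨V, q, h, hxV, hh⟩ := hF x
  have he' := he.restrict (inf_le_left : U ⊓ V ≤ U)
  have hh' := hh.restrict (inf_le_right : U ⊓ V ≤ V)
  obtain ⟨A, hA⟩ := hh'.exists_isMatrixOf φ _
  exact ⟨U ⊓ V, p, q, _, _, A, ⟨hxU, hxV⟩, he', hh', hA⟩

lemma minorStalk_local (hE : IsLocallyFreeOfFiniteRank E) (hF : IsLocallyFreeOfFiniteRank F)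
    (φ : E ⟶ F) (k : ℕ) (x : X) : ∃ (U : X.Opens) (J : Ideal Γ(X, U)), x ∈ U ∧
      ∀ (y : X) (hy : y ∈ U), minorStalk φ k y = J.map (X.presheaf.germ U y hy).hom := by
  obtain ⟨U, p, q, e, h, A, hx, he, hh, hA⟩ := exists_isMatrixOf hE hF φ x
  exact ⟨U, A.minorIdeal k, hx, fun y hy => minorStalk_eq he hh hA y hy⟩

/-- The sheaf with stalks `minorStalk` contains all minors, hence contains the infimum. Conversely,
an ideal sheaf containing all minors contains this one, as is seen on stalks. -/
lemma determinantalIdeal_eq (hE : IsLocallyFreeOfFiniteRank E) (hF : IsLocallyFreeOfFiniteRank F)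
    (φ : E ⟶ F) (r : ℕ) : determinantalIdeal φ r =
      IdealSheafData.ofStalks _ (minorStalk_local hE hF φ (r + 1)) := by
  refine le_antisymm (sInf_le fun U a ha => ?_) (le_sInf fun J hJ U a ha => ?_)
  · exact IdealSheafData.mem_stalkwiseIdeal.2 fun x hx => Ideal.subset_span ⟨U, hx, a, ha, rfl⟩
  · refine U.2.mem_ideal_iff.2 fun x hx => ?_
    refine (Ideal.span_le.2 ?_) (IdealSheafData.mem_stalkwiseIdeal.1 ha x hx)
    rintro _ ⟨V, hxV, b, hb, rfl⟩
    obtain ⟨_, ⟨W, hW, rfl⟩, hxW, hWU⟩ := X.isBasis_affineOpens.exists_subset_of_mem_open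
      (show x ∈ ((U.1 ⊓ V.1 : X.Opens) : Set X) from ⟨hx, hxV⟩) (U.1 ⊓ V.1).isOpen
    let W' : X.affineOpens := ⟨W, hW⟩
    have hWU' : W' ≤ U := fun y hy => (hWU hy).1
    have hWV' : W' ≤ V := fun y hy => (hWU hy).2
    -- The stalk of `J` at `x` may be computed from any affine neighbourhood; this moves between `U`
    -- and `V`.
    have key (T : X.affineOpens) (hT : W' ≤ T) :
        (J.ideal T).map (X.presheaf.germ T.1 x (hT hxW)).hom =
          (J.ideal W').map (X.presheaf.germ W'.1 x hxW).hom :=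
      (IdealSheafData.map_germ_res hT _ hxW).symm.trans
        (congrArg (Ideal.map (X.presheaf.germ W'.1 x hxW).hom) (J.map_ideal hT))
    rw [key U hWU', ← key V hWV']
    exact Ideal.mem_map_of_mem _ (hJ V b hb)

lemma determinantalIdeal_ideal_eq (hE : IsLocallyFreeOfFiniteRank E)
    (hF : IsLocallyFreeOfFiniteRank F) {φ : E ⟶ F} {r p q : ℕ} {U : X.affineOpens}
    {e : Fin p → Γ(E, U)} {h : Fin q → Γ(F, U)} {A : Matrix (Fin q) (Fin p) Γ(X, U)}
    (he : IsFrame E U e) (hh : IsFrame F U h) (hA : IsMatrixOf φ e h A) :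
    (determinantalIdeal φ r).ideal U = A.minorIdeal (r + 1) := by
  rw [determinantalIdeal_eq hE hF]
  exact IdealSheafData.stalkwiseIdeal_eq U.2 fun y hy => minorStalk_eq he hh hA y hy

end AlgebraicGeometry.Scheme.Modules

/-! ### Charts of the affine blow-up -/

namespace ReesGrading

open Polynomial HomogeneousLocalization

variable {R S : Type u} [CommRing R] [CommRing S] {I : Ideal R}

/-- The element `b Xⁿ` of the Rees algebra. -/
noncomputable def mono (n : ℕ) (b : R) (hb : b ∈ I ^ n) : reesAlgebra I :=
  ⟨monomial n b, reesAlgebra.monomial_mem.2 hb⟩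

lemma mono_mem (n : ℕ) (b : R) (hb : b ∈ I ^ n) : mono n b hb ∈ piece I n := fun i hi => by
  simp [mono, coeff_monomial, hi.symm]

lemma eq_mono_of_mem {n : ℕ} {f : reesAlgebra I} (hf : f ∈ piece I n) :
    f = mono n ((f : R[X]).coeff n) (f.2 n) := by
  ext i
  by_cases hi : i = n
  · subst hi; simp [mono]
  · rw [hf i hi, mono_mem n _ _ i hi]

/-- The degree one element `a X` of the Rees algebra. -/
noncomputable def gen (a : I) : reesAlgebra I := mono 1 a.1 (by simp)

lemma gen_mem (a : I) : gen a ∈ piece I 1 := mono_mem _ _ _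

/-- The structure map from `R` to the homogeneous localization of the Rees algebra at `a X`. -/
noncomputable def toAway (a : I) : R →+* Away (piece I) (gen a) :=
  (fromZeroRingHom (piece I) (Submonoid.powers (gen a))).comp (algebraMapZero I)

lemma val_toAway (a : I) (r : R) :
    (toAway a r).val = Localization.mk (algebraMap R (reesAlgebra I) r) 1 := by
  change (HomogeneousLocalization.mk _).val = _
  rw [val_mk]
  rfl

/-- The fraction `b Xⁿ / (a X)ⁿ`. -/
noncomputable def frac (a : I) (n : ℕ) (b : R) (hb : b ∈ I ^ n) : Away (piece I) (gen a) :=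
  Away.mk (piece I) (gen_mem a) n (mono n b hb) (by simpa using mono_mem n b hb)

lemma exists_eq_frac (a : I) (x : Away (piece I) (gen a)) : ∃ n b hb, x = frac a n b hb := by
  obtain ⟨n, f, hf, rfl⟩ := Away.mk_surjective (piece I) (gen_mem a) x
  have hf' : f ∈ piece I n := by simpa using hf
  refine ⟨n, (f : R[X]).coeff n, f.2 n, ?_⟩
  ext
  rw [frac, Away.val_mk, Away.val_mk, ← eq_mono_of_mem hf']

lemma frac_mul (a : I) (n : ℕ) (b : R) (hb : b ∈ I ^ n) :
    frac a n b hb * toAway a (a : R) ^ n = toAway a b := by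
  ext
  rw [← map_pow, val_mul, val_toAway, val_toAway, frac, Away.val_mk, Localization.mk_mul,
    Localization.mk_eq_mk_iff, Localization.r_iff_exists]
  refine ⟨1, ?_⟩
  have h1 : (gen a : reesAlgebra I) ^ n = mono n ((a : R) ^ n) (Ideal.pow_mem_pow a.2 n) := by
    ext1
    simp [gen, mono, monomial_pow]
  have : mono n b hb * algebraMap R (reesAlgebra I) (a ^ n : R) =
      gen a ^ n * algebraMap R (reesAlgebra I) b := by
    rw [h1]
    ext1
    change monomial n b * C (a ^ n : R) = monomial n (a ^ n : R) * C b
    rw [monomial_mul_C, monomial_mul_C, mul_comm]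
  simpa using this

/-- Every element is a fraction `b / aⁿ`, and its image is determined after multiplication by the
image of `aⁿ`, which can be cancelled. -/
lemma away_ringHom_ext (a : I) {θ θ' : Away (piece I) (gen a) →+* S}
    (h : θ.comp (toAway a) = θ'.comp (toAway a))
    (ha : θ (toAway a a) ∈ nonZeroDivisors S) : θ = θ' := by
  ext x
  obtain ⟨n, b, hb, rfl⟩ := exists_eq_frac a x
  have h' (r) : θ (toAway a r) = θ' (toAway a r) := congr($h r)
  refine (mul_cancel_right_mem_nonZeroDivisors (pow_mem ha n)).1 ?_
  rw [← map_pow, ← map_mul, frac_mul, h', ← frac_mul a n b hb, map_mul, map_pow, map_pow, h']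

lemma map_le_span_of_comp_toAway (a : I) {θ : Away (piece I) (gen a) →+* S} {φ : R →+* S}
    (h : θ.comp (toAway a) = φ) : I.map φ ≤ Ideal.span {φ a} := by
  subst h
  refine Ideal.map_le_iff_le_comap.2 fun b hb => Ideal.mem_span_singleton.2 ?_
  have := frac_mul a 1 b (by simpa using hb)
  rw [pow_one (toAway a _)] at this
  exact ⟨θ (frac a 1 b (by simpa using hb)), by
    rw [RingHom.comp_apply, RingHom.comp_apply, ← this, map_mul, mul_comm]⟩

lemma mono_mem_span (n : ℕ) (b : R) (hb : b ∈ I ^ (n + 1)) :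
    mono (n + 1) b hb ∈ Ideal.span (Set.range (gen (I := I))) := by
  -- Quantifying over all `f` with the given polynomial keeps membership proofs out of the induction
  -- on `I * I ^ n`.
  suffices H : ∀ b ∈ I ^ (n + 1), ∀ f : reesAlgebra I, (f : R[X]) = monomial (n + 1) b →
      f ∈ Ideal.span (Set.range (gen (I := I))) from H b hb _ rfl
  intro b hb
  rw [pow_succ'] at hb
  induction hb using Submodule.mul_induction_on' with
  | mem_mul_mem a ha c hc =>
    intro f hf
    have : f = mono n c hc * gen ⟨a, ha⟩ := by
      ext1
      rw [hf]
      simp [mono, gen, monomial_mul_monomial, mul_comm]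
    rw [this]
    exact Ideal.mul_mem_left _ _ (Ideal.subset_span ⟨_, rfl⟩)
  | add x hx y hy h1 h2 =>
    intro f hf
    rw [← pow_succ'] at hx hy
    have : f = mono (n + 1) x hx + mono (n + 1) y hy := by
      ext1
      rw [hf]
      simp [mono]
    rw [this]
    exact add_mem (h1 _ rfl) (h2 _ rfl)

lemma irrelevant_le_span :
    (HomogeneousIdeal.irrelevant (piece I)).toIdeal ≤ Ideal.span (Set.range (gen (I := I))) := by
  classical
  intro f hf
  rw [← DirectSum.sum_support_decompose (piece I) f]
  refine Ideal.sum_mem _ fun n hn => ?_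
  rcases n with - | n
  · have : DirectSum.decompose (piece I) f 0 = 0 := by
      have := (HomogeneousIdeal.mem_irrelevant_iff _ _).1 hf
      exact Subtype.ext this
    rw [this]
    exact Ideal.zero_mem _
  · rw [eq_mono_of_mem (SetLike.coe_mem (DirectSum.decompose (piece I) f (n + 1)))]
    exact mono_mem_span _ _ _

lemma iSup_basicOpen_gen : ⨆ a : I, Proj.basicOpen (piece I) (gen a) = ⊤ :=
  Proj.iSup_basicOpen_eq_top _ _ irrelevant_le_span

/-- The chart of the affine blow-up defined by `a ∈ I`. -/
noncomputable abbrev chart (a : I) : Spec (.of (Away (piece I) (gen a))) ⟶ affineBlowup I :=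
  Proj.awayι (piece I) (gen a) (gen_mem a) one_pos

lemma chart_affineBlowupπ (a : I) :
    chart a ≫ affineBlowupπ I = Spec.map (CommRingCat.ofHom (toAway a)) := by
  rw [affineBlowupπ, Proj.awayι_toSpecZero_assoc, ← Spec.map_comp, ← CommRingCat.ofHom_comp]
  rfl

end ReesGrading

namespace AlgebraicGeometry.Scheme

lemma hom_ext_of_opens {X Y : Scheme.{u}} {f g : X ⟶ Y}
    (h : ∀ x : X, ∃ U : X.Opens, x ∈ U ∧ U.ι ≫ f = U.ι ≫ g) : f = g := by
  choose U hU h using h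
  exact (X.openCoverOfIsOpenCover U (.mk (eq_top_iff.2 fun x _ =>
    TopologicalSpace.Opens.mem_iSup.2 ⟨x, hU x⟩))).hom_ext _ _ h

lemma hom_ext_of_openImmersion {X Y : Scheme.{u}} {f g : X ⟶ Y}
    (h : ∀ x : X, ∃ (W : Scheme.{u}) (j : W ⟶ X) (_ : IsOpenImmersion j),
      x ∈ j.opensRange ∧ j ≫ f = j ≫ g) : f = g := by
  refine hom_ext_of_opens fun x => ?_
  obtain ⟨W, j, hj, hx, e⟩ := h x
  refine ⟨j.opensRange, hx, ?_⟩
  rw [← cancel_epi j.isoOpensRange.hom]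
  simpa using e

end AlgebraicGeometry.Scheme

/-! ### Uniqueness of lifts to the affine blow-up -/

namespace ReesGrading

open Polynomial HomogeneousLocalization

variable {R S : Type u} [CommRing R] [CommRing S] {I : Ideal R}

lemma exists_eq_specMap_chart {a : I} {g : Spec (.of S) ⟶ affineBlowup I}
    (hg : ∀ z, g z ∈ Proj.basicOpen (piece I) (gen a)) :
    ∃ θ : Away (piece I) (gen a) →+* S, g = Spec.map (CommRingCat.ofHom θ) ≫ chart a := by
  have h : Set.range g ⊆ Set.range (chart a) := by
    rintro _ ⟨z, rfl⟩
    have := hg z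
    rw [← Proj.opensRange_awayι (piece I) (gen a) (gen_mem a) one_pos] at this
    exact this
  refine ⟨(Spec.preimage (IsOpenImmersion.lift (chart a) g h)).hom, ?_⟩
  rw [CommRingCat.ofHom_hom, Spec.map_preimage, IsOpenImmersion.lift_fac]

lemma comp_toAway_eq {a : I} {θ : Away (piece I) (gen a) →+* S} {φ : R →+* S}
    (h : (Spec.map (CommRingCat.ofHom θ) ≫ chart a) ≫ affineBlowupπ I =
      Spec.map (CommRingCat.ofHom φ)) : θ.comp (toAway a) = φ := by
  rw [Category.assoc, chart_affineBlowupπ, ← Spec.map_comp, Spec.map_inj,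
    ← CommRingCat.ofHom_comp] at h
  exact congr(($h).hom)

/-- Both `a'` and `a` generate the extended ideal: `φ a' = φ a * v`, while `φ a` is the image of `a
/ a'` times `φ a'`. Cancelling `φ a` makes the image of `a / a'` a unit. -/
lemma mem_basicOpen_gen {a a' : I} {θ : Away (piece I) (gen a') →+* S} {φ : R →+* S}
    (h : θ.comp (toAway a') = φ) (ha : I.map φ ≤ Ideal.span {φ a})
    (hn : φ a ∈ nonZeroDivisors S) (z : Spec (.of S)) :
    (Spec.map (CommRingCat.ofHom θ) ≫ chart a') z ∈ Proj.basicOpen (piece I) (gen a) := by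
  rw [Scheme.Hom.comp_apply]
  change Spec.map (CommRingCat.ofHom θ) z ∈ chart a' ⁻¹ᵁ Proj.basicOpen (piece I) (gen a)
  rw [Proj.awayι_preimage_basicOpen (piece I) (gen_mem a') one_pos (gen_mem a) one_pos]
  have h1 : Away.isLocalizationElem (gen_mem a') (gen_mem a) = frac a' 1 a.1 (by simp) := by
    ext
    rw [frac, Away.val_mk, Away.val_mk, pow_one]
    rfl
  rw [h1]
  have hu : IsUnit (θ (frac a' 1 a.1 (by simp))) := by
    obtain ⟨v, hv⟩ := Ideal.mem_span_singleton.1 (ha (Ideal.mem_map_of_mem φ a'.2))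
    have h2 := congr(θ $(frac_mul a' 1 a.1 (by simp)))
    have h3 (r) : θ (toAway a' r) = φ r := congr($h r)
    rw [pow_one (toAway a' _), map_mul, h3, h3, hv] at h2
    refine IsUnit.of_mul_eq_one v ((mul_cancel_right_mem_nonZeroDivisors hn).1 ?_)
    rw [one_mul]
    conv_rhs => rw [← h2]
    ring
  intro hz
  exact z.2.ne_top (Ideal.eq_top_of_isUnit_mem _ (show _ ∈ z.asIdeal from hz) hu)

/-- Locally `g` lands in the chart of some `a` and `g'` in that of some `a'`. The image of `a` then
generates the extended ideal and is a nonzerodivisor, so `g'` lands in the chart of `a` too, where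
`away_ringHom_ext` applies. -/
lemma affineBlowup_hom_ext {φ : R →+* S} {q : S} (hq : q ∈ nonZeroDivisors S)
    (hI : I.map φ = Ideal.span {q}) {g g' : Spec (.of S) ⟶ affineBlowup I}
    (hg : g ≫ affineBlowupπ I = Spec.map (CommRingCat.ofHom φ))
    (hg' : g' ≫ affineBlowupπ I = Spec.map (CommRingCat.ofHom φ)) : g = g' := by
  refine Scheme.hom_ext_of_openImmersion fun z => ?_
  obtain ⟨a, ha⟩ : ∃ a : I, g z ∈ Proj.basicOpen (piece I) (gen a) :=
    TopologicalSpace.Opens.mem_iSup.1 (iSup_basicOpen_gen.ge (Set.mem_univ _))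
  obtain ⟨a', ha'⟩ : ∃ a : I, g' z ∈ Proj.basicOpen (piece I) (gen a) :=
    TopologicalSpace.Opens.mem_iSup.1 (iSup_basicOpen_gen.ge (Set.mem_univ _))
  let O : (Spec (.of S)).Opens := g ⁻¹ᵁ Proj.basicOpen (piece I) (gen a) ⊓
    g' ⁻¹ᵁ Proj.basicOpen (piece I) (gen a')
  obtain ⟨_, ⟨t, rfl⟩, hzt, htO⟩ := PrimeSpectrum.isTopologicalBasis_basic_opens.exists_subset_of_mem_open
    (show z ∈ (O : Set _) from ⟨ha, ha'⟩) O.isOpen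
  let j : Spec (.of (Localization.Away t)) ⟶ Spec (.of S) :=
    Spec.map (CommRingCat.ofHom (algebraMap S (Localization.Away t)))
  have hj : IsOpenImmersion j := IsOpenImmersion.of_isLocalization t
  have hjr : Set.range j = (PrimeSpectrum.basicOpen t : Set (PrimeSpectrum S)) :=
    PrimeSpectrum.localization_away_comap_range (Localization.Away t) t
  refine ⟨_, j, hj, hjr.ge hzt, ?_⟩
  have hjO (w) : j w ∈ O := htO (hjr.le ⟨w, rfl⟩)
  obtain ⟨θ, hθ⟩ := exists_eq_specMap_chart (g := j ≫ g) (a := a) fun w => by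
    rw [Scheme.Hom.comp_apply]; exact (hjO w).1
  obtain ⟨θ', hθ'⟩ := exists_eq_specMap_chart (g := j ≫ g') (a := a') fun w => by
    rw [Scheme.Hom.comp_apply]; exact (hjO w).2
  set ψ : R →+* Localization.Away t := (algebraMap S (Localization.Away t)).comp φ with hψ
  have e (g : Spec (.of S) ⟶ affineBlowup I)
      (hg : g ≫ affineBlowupπ I = Spec.map (CommRingCat.ofHom φ)) :
      (j ≫ g) ≫ affineBlowupπ I = Spec.map (CommRingCat.ofHom ψ) := by
    rw [Category.assoc, hg, ← Spec.map_comp, ← CommRingCat.ofHom_comp]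
  have h1 := comp_toAway_eq (hθ ▸ e g hg)
  have h1' := comp_toAway_eq (hθ' ▸ e g' hg')
  have hIψ : I.map ψ = Ideal.span {algebraMap S (Localization.Away t) q} := by
    rw [hψ, ← Ideal.map_map, hI, Ideal.map_span, Set.image_singleton]
  have hqt : algebraMap S (Localization.Away t) q ∈ nonZeroDivisors (Localization.Away t) :=
    IsLocalization.map_nonZeroDivisors_le (.powers t) _ (Submonoid.mem_map_of_mem _ hq)
  -- A divisor of the nonzerodivisor `q` is a nonzerodivisor.
  have han : ψ a ∈ nonZeroDivisors (Localization.Away t) := by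
    have := map_le_span_of_comp_toAway a h1
    rw [hIψ, Ideal.span_singleton_le_iff_mem, Ideal.mem_span_singleton] at this
    obtain ⟨v, hv⟩ := this
    rw [hv, mul_mem_nonZeroDivisors] at hqt
    exact hqt.1
  have h2 := map_le_span_of_comp_toAway a h1
  obtain ⟨θ'', hθ''⟩ := exists_eq_specMap_chart (g := j ≫ g') (a := a) fun w => by
    rw [hθ']; exact mem_basicOpen_gen h1' h2 han w
  have h1'' := comp_toAway_eq (hθ'' ▸ e g' hg')
  rw [hθ, hθ'', away_ringHom_ext a (h1.trans h1''.symm) ?_]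
  have : θ (toAway a a) = ψ a := congr($h1 a)
  rwa [this]

end ReesGrading

/-! ### Existence of lifts to the affine blow-up -/

namespace ReesGrading

open Polynomial HomogeneousLocalization

variable {R S : Type u} [CommRing R] [CommRing S] {I : Ideal R}

/-- If `I S` is generated by a nonzerodivisor `q`, then `b Xⁿ ↦ b / qⁿ` is a homomorphism from the
Rees algebra of `I` to `S`. -/
lemma exists_reesAlgebra_hom {φ : R →+* S} {q : S} (hq : q ∈ nonZeroDivisors S)
    (hI : I.map φ = Ideal.span {q}) :
    ∃ ρ : reesAlgebra I →+* S, ∀ n b hb, q ^ n * ρ (mono n b hb) = φ b := by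
  -- Division by `q` is done in `S[1/q]`, which contains `S`; the values lie in `S` because `φ b ∈ q
  -- ^ n S` for `b ∈ I ^ n`.
  let L := Localization.Away q
  have hinj : Function.Injective (algebraMap S L) :=
    IsLocalization.injective L (Submonoid.powers_le.2 hq)
  have hu : algebraMap S L q * IsLocalization.Away.invSelf q = 1 :=
    IsLocalization.Away.mul_invSelf q
  let ε : reesAlgebra I →+* L :=
    (eval₂RingHom ((algebraMap S L).comp φ) (IsLocalization.Away.invSelf q)).comp
      (reesAlgebra I).val.toRingHom
  have hε (n b hb) : ε (mono n b hb) = algebraMap S L (φ b) * IsLocalization.Away.invSelf q ^ n := by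
    simp [ε, mono]
  have hmono (n b hb) : ∃ c, φ b = q ^ n * c ∧ ε (mono n b hb) = algebraMap S L c := by
    have h1 : φ b ∈ (I ^ n).map φ := Ideal.mem_map_of_mem _ hb
    rw [Ideal.map_pow, hI, Ideal.span_singleton_pow, Ideal.mem_span_singleton] at h1
    obtain ⟨c, hc⟩ := h1
    refine ⟨c, hc, ?_⟩
    rw [hε, hc, map_mul, map_pow, mul_right_comm, ← mul_pow, hu, one_pow, one_mul]
  have hrange (f) : ε f ∈ (algebraMap S L).range := by
    classical
    rw [← DirectSum.sum_support_decompose (piece I) f, map_sum]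
    refine Subring.sum_mem _ fun n _ => ?_
    rw [eq_mono_of_mem (SetLike.coe_mem (DirectSum.decompose (piece I) f n))]
    obtain ⟨c, -, hc⟩ := hmono n _ ((DirectSum.decompose (piece I) f n : reesAlgebra I).2 n)
    exact ⟨c, hc.symm⟩
  let κ : S ≃+* (algebraMap S L).range :=
    RingEquiv.ofBijective (algebraMap S L).rangeRestrict
      ⟨fun x y h => hinj congr(($h : L)), RingHom.rangeRestrict_surjective _⟩
  refine ⟨κ.symm.toRingHom.comp (ε.codRestrict _ hrange), fun n b hb => ?_⟩
  obtain ⟨c, hc, hc'⟩ := hmono n b hb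
  have : (ε.codRestrict _ hrange) (mono n b hb) = κ c := Subtype.ext hc'
  simp [this, hc]

lemma exists_affineBlowup_lift {φ : R →+* S} {q : S} (hq : q ∈ nonZeroDivisors S)
    (hI : I.map φ = Ideal.span {q}) :
    ∃ g : Spec (.of S) ⟶ affineBlowup I,
      g ≫ affineBlowupπ I = Spec.map (CommRingCat.ofHom φ) := by
  obtain ⟨ρ, hρ⟩ := exists_reesAlgebra_hom hq hI
  have h0 (r : R) : ρ (algebraMap R (reesAlgebra I) r) = φ r := by
    have := hρ 0 r (by simp)
    rw [pow_zero, one_mul] at this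
    exact this
  -- A ring map from the Rees algebra defines a morphism to `Proj` once the irrelevant ideal
  -- generates the unit ideal. Here `q ∈ I S` is `q` times an element of the generated ideal, and
  -- cancelling `q` shows that this element is `1`.
  have htop : (HomogeneousIdeal.irrelevant (piece I)).toIdeal.map ρ = ⊤ := by
    have h1 : I.map φ ≤ Ideal.span {q} *
        (HomogeneousIdeal.irrelevant (piece I)).toIdeal.map ρ := by
      refine Ideal.map_le_iff_le_comap.2 fun b hb => ?_
      rw [Ideal.mem_comap, ← hρ 1 b (by simpa using hb), pow_one]
      exact Ideal.mul_mem_mul (Ideal.mem_span_singleton_self q) (Ideal.mem_map_of_mem _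
        (HomogeneousIdeal.mem_irrelevant_of_mem _ one_pos (mono_mem _ _ _)))
    have h2 := h1 (hI ▸ Ideal.mem_span_singleton_self q)
    obtain ⟨j, hj, hqj⟩ := Ideal.mem_span_singleton_mul.1 h2
    rw [Ideal.eq_top_iff_one]
    have : j = 1 := (mul_cancel_left_mem_nonZeroDivisors hq).1 (by rw [hqj, mul_one])
    exact this ▸ hj
  let γ := (Scheme.ΓSpecIso (.of S)).inv.hom
  have htop' : (HomogeneousIdeal.irrelevant (piece I)).toIdeal.map (γ.comp ρ) = ⊤ := by
    rw [← Ideal.map_map, htop, Ideal.map_top]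
  refine ⟨Proj.fromOfGlobalSections (piece I) (γ.comp ρ) htop', ?_⟩
  rw [affineBlowupπ, Proj.fromOfGlobalSections_toSpecZero_assoc, ← Spec.map_comp,
    ← CommRingCat.ofHom_comp]
  have : ((γ.comp ρ).comp (algebraMap (piece I 0) (reesAlgebra I))).comp (algebraMapZero I) =
      γ.comp φ := by
    ext r
    exact congrArg γ (h0 r)
  rw [this, CommRingCat.ofHom_comp, Spec.map_comp, ← Category.assoc]
  have h3 : (Spec (.of S)).toSpecΓ ≫ Spec.map (Scheme.ΓSpecIso (.of S)).inv = 𝟙 _ := by simp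
  exact (congrArg (· ≫ _) h3).trans (Category.id_comp _)

end ReesGrading

/-! ### Universal property of the blow-up of a scheme -/

namespace AlgebraicGeometry.Scheme.IdealSheafData

open AffineZariskiSite

variable {X Z : Scheme.{u}} (I : X.IdealSheafData)

lemma exists_isPullback_blowupπ {U : X.Opens} (hU : IsAffineOpen U) :
    ∃ i : I.blowupChart ⟨U, hU⟩ ⟶ I.blowup,
      IsPullback (I.blowupChartToSpec ⟨U, hU⟩) i hU.fromSpec I.blowupπ := by
  obtain ⟨i, h⟩ : ∃ i : I.blowupChart ⟨U, hU⟩ ⟶ I.blowup,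
      IsPullback (I.blowupChartToSpec ⟨U, hU⟩ ≫ hU.isoSpec.inv) i U.ι I.blowupπ :=
    ⟨_, I.blowupGluingData.isPullback_natTrans_ι_toBase ⟨U, hU⟩⟩
  exact ⟨i, h.of_iso (Iso.refl _) hU.isoSpec (Iso.refl _) (Iso.refl _) (by simp) (by simp) (by simp)
    (by simp)⟩

/-- Locally on `Z`, the inverse image of `I` under `f` is generated by a nonzerodivisor. -/
def IsInvertibleAlong (f : Z ⟶ X) : Prop :=
  ∀ z : Z, ∃ (U : X.Opens) (hU : IsAffineOpen U) (V : Z.Opens) (_ : IsAffineOpen V)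
    (e : V ≤ f ⁻¹ᵁ U), z ∈ V ∧ ∃ q ∈ nonZeroDivisors Γ(Z, V),
      (I.ideal ⟨U, hU⟩).map (f.appLE U V e).hom = Ideal.span {q}

variable {I}

lemma existsUnique_blowup_lift_fromSpec {f : Z ⟶ X} {U : X.Opens} (hU : IsAffineOpen U)
    {V : Z.Opens} (hV : IsAffineOpen V)
    (e : V ≤ f ⁻¹ᵁ U) {q : Γ(Z, V)} (hq : q ∈ nonZeroDivisors Γ(Z, V))
    (hI : (I.ideal ⟨U, hU⟩).map (f.appLE U V e).hom = Ideal.span {q}) :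
    ∃! g : Spec Γ(Z, V) ⟶ I.blowup, g ≫ I.blowupπ = hV.fromSpec ≫ f := by
  obtain ⟨i, hi⟩ := I.exists_isPullback_blowupπ hU
  have hf := IsAffineOpen.SpecMap_appLE_fromSpec f hU hV e
  obtain ⟨g, hg⟩ : ∃ g : Spec Γ(Z, V) ⟶ I.blowupChart ⟨U, hU⟩,
      g ≫ I.blowupChartToSpec ⟨U, hU⟩ = Spec.map (f.appLE U V e) :=
    ReesGrading.exists_affineBlowup_lift hq hI
  have key : (g ≫ i) ≫ I.blowupπ = hV.fromSpec ≫ f := by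
    rw [Category.assoc, ← hi.w, ← hf, reassoc_of% hg]
  refine ⟨g ≫ i, key, fun g' hg' => ?_⟩
  have hg'' : Spec.map (f.appLE U V e) ≫ hU.fromSpec = g' ≫ I.blowupπ := hf.trans hg'.symm
  have h1 : hi.lift _ _ hg'' ≫ ReesGrading.affineBlowupπ (I.ideal ⟨U, hU⟩) =
    Spec.map (CommRingCat.ofHom (f.appLE U V e).hom) := hi.lift_fst _ _ hg''
  have h2 := ReesGrading.affineBlowup_hom_ext hq hI hg h1
  rw [h2]
  exact (hi.lift_snd _ _ hg'').symm

lemma map_mem_nonZeroDivisors_of_flat {R S : Type*} [CommRing R] [CommRing S] {φ : R →+* S}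
    (hφ : φ.Flat) {q : R} (hq : q ∈ nonZeroDivisors R) : φ q ∈ nonZeroDivisors S := by
  let := φ.toAlgebra
  have : Module.Flat R S := hφ
  have hr := Module.Flat.isSMulRegular_of_nonZeroDivisors (M := S) hq
  rw [mem_nonZeroDivisors_iff_right]
  intro x hx
  refine hr (a₁ := x) (a₂ := 0) ?_
  rw [mul_comm] at hx
  change q • x = q • 0
  rw [smul_zero, Algebra.smul_def]
  exact hx

/-- Flat ring maps preserve nonzerodivisors. The case of open immersions gives uniqueness of lifts
on the overlaps of a covering. -/
lemma IsInvertibleAlong.comp {W : Scheme.{u}} {f : Z ⟶ X} (h : I.IsInvertibleAlong f) (j : W ⟶ Z)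
    [Flat j] : I.IsInvertibleAlong (j ≫ f) := by
  intro w
  obtain ⟨U, hU, V, hV, e, hz, q, hq, hI⟩ := h (j w)
  obtain ⟨_, ⟨V', hV', rfl⟩, hw, hVV⟩ := W.isBasis_affineOpens.exists_subset_of_mem_open
    (show w ∈ ((j ⁻¹ᵁ V : W.Opens) : Set W) from hz) (j ⁻¹ᵁ V).isOpen
  replace hVV : V' ≤ j ⁻¹ᵁ V := hVV
  refine ⟨U, hU, V', hV', hVV.trans fun x hx => e hx, hw, (j.appLE V V' hVV).hom q,
    map_mem_nonZeroDivisors_of_flat ?_ hq, ?_⟩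
  · exact HasRingHomProperty.appLE @Flat j inferInstance ⟨V, hV⟩ ⟨V', hV'⟩ hVV
  · rw [← Scheme.Hom.appLE_comp_appLE j f U V V' e hVV, CommRingCat.hom_comp, ← Ideal.map_map, hI,
      Ideal.map_span, Set.image_singleton]

lemma IsInvertibleAlong.blowup_hom_ext {f : Z ⟶ X} (h : I.IsInvertibleAlong f)
    {g g' : Z ⟶ I.blowup} (hg : g ≫ I.blowupπ = f) (hg' : g' ≫ I.blowupπ = f) : g = g' := by
  refine hom_ext_of_openImmersion fun z => ?_
  obtain ⟨U, hU, V, hV, e, hz, q, hq, hI⟩ := h z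
  refine ⟨_, hV.fromSpec, hV.isOpenImmersion_fromSpec, by rwa [hV.opensRange_fromSpec],
    (existsUnique_blowup_lift_fromSpec hU hV e hq hI).unique ?_ ?_⟩
  · rw [Category.assoc, hg]
  · rw [Category.assoc, hg']

lemma exists_glue_of_opens {Y : Scheme.{u}} (V : Z → Z.Opens) (hV : ∀ z, z ∈ V z)
    (G : ∀ z, (V z).toScheme ⟶ Y)
    (hG : ∀ x y, Limits.pullback.fst (V x).ι (V y).ι ≫ G x =
      Limits.pullback.snd (V x).ι (V y).ι ≫ G y) :
    ∃ g : Z ⟶ Y, ∀ z, (V z).ι ≫ g = G z := by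
  let 𝒰 : Z.OpenCover := Z.openCoverOfIsOpenCover V (.mk (eq_top_iff.2 fun x _ =>
    TopologicalSpace.Opens.mem_iSup.2 ⟨x, hV x⟩))
  exact ⟨𝒰.glueMorphisms G hG, fun z => 𝒰.ι_glueMorphisms G hG z⟩

/-- The universal property of the blow-up. -/
theorem IsInvertibleAlong.existsUnique_blowup_lift {f : Z ⟶ X} (h : I.IsInvertibleAlong f) :
    ∃! g : Z ⟶ I.blowup, g ≫ I.blowupπ = f := by
  have h' := h
  choose U hU V hV e hz q hq hI using h
  choose g hg _ using fun z => existsUnique_blowup_lift_fromSpec (hU z) (hV z) (e z) (hq z) (hI z)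
  have hG (z : Z) : ((hV z).isoSpec.hom ≫ g z) ≫ I.blowupπ = (V z).ι ≫ f := by
    rw [Category.assoc, hg, IsAffineOpen.isoSpec_hom_fromSpec_assoc]
  -- The local lifts agree on overlaps by uniqueness there.
  obtain ⟨G, hGV⟩ := exists_glue_of_opens V hz (fun z => (hV z).isoSpec.hom ≫ g z) fun x y => by
    refine (h'.comp (Limits.pullback.fst (V x).ι (V y).ι ≫ (V x).ι)).blowup_hom_ext ?_ ?_
    · rw [Category.assoc, hG, Category.assoc]
    · rw [Limits.pullback.condition, Category.assoc, hG, Category.assoc]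
  have hGf : G ≫ I.blowupπ = f := hom_ext_of_opens fun z => ⟨V z, hz z, by
    rw [← Category.assoc, hGV, hG]⟩
  exact ⟨G, hGf, fun g' hg' => h'.blowup_hom_ext hg' hGf⟩

end AlgebraicGeometry.Scheme.IdealSheafData

/-! ### Associated points and invertibility of the determinantal ideals -/

namespace AlgebraicGeometry.Scheme

variable {X Z : Scheme.{u}}

lemma maximalIdeal_mem_associatedPrimes_of_atPrime {R S : Type*} [CommRing R] [CommRing S]
    [Algebra R S] (P : Ideal R) [P.IsPrime] [IsLocalization.AtPrime S P] [IsLocalRing S]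
    (hP : P ∈ associatedPrimes R R) :
    IsLocalRing.maximalIdeal S ∈ associatedPrimes S S := by
  refine Module.associatedPrimes.mem_associatedPrimes_of_comap_mem_associatedPrimes_of_isLocalizedModule
    P.primeCompl (Algebra.linearMap R S) _ ?_
  have h : (IsLocalRing.maximalIdeal S).comap (algebraMap R S) = P :=
    IsLocalization.AtPrime.under_maximalIdeal S P
  rwa [h]

/-- This turns the condition on associated points of `Z` into one on associated primes of its rings
of sections. -/
lemma isAssociatedPoint_fromSpec {V : Z.Opens} (hV : IsAffineOpen V)
    (P : PrimeSpectrum Γ(Z, V)) (hP : P.asIdeal ∈ associatedPrimes Γ(Z, V) Γ(Z, V)) :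
    IsAssociatedPoint (hV.fromSpec P) := by
  have hPV : hV.fromSpec P ∈ V := hV.range_fromSpec.le ⟨P, rfl⟩
  let := TopCat.Presheaf.algebra_section_stalk Z.presheaf ⟨hV.fromSpec P, hPV⟩
  have : IsLocalization.AtPrime (Z.presheaf.stalk (hV.fromSpec P)) P.asIdeal :=
    hV.isLocalization_stalk' P hPV
  exact maximalIdeal_mem_associatedPrimes_of_atPrime P.asIdeal hP

lemma germ_mem_maximalIdeal_fromSpec {V : Z.Opens} (hV : IsAffineOpen V)
    (P : PrimeSpectrum Γ(Z, V)) (hPV : hV.fromSpec P ∈ V) {s : Γ(Z, V)} (hs : s ∈ P.asIdeal) :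
    Z.presheaf.germ V (hV.fromSpec P) hPV s ∈ IsLocalRing.maximalIdeal _ := by
  let := TopCat.Presheaf.algebra_section_stalk Z.presheaf ⟨hV.fromSpec P, hPV⟩
  have : IsLocalization.AtPrime (Z.presheaf.stalk (hV.fromSpec P)) P.asIdeal :=
    hV.isLocalization_stalk' P hPV
  exact (IsLocalization.AtPrime.to_map_mem_maximal_iff _ P.asIdeal s).2 hs

namespace Modules

variable {E F : X.Modules}

lemma IsMinor.pullback {φ : E ⟶ F} {k : ℕ} {U : X.Opens} {a : Γ(X, U)} (ha : IsMinor φ k U a)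
    (f : Z ⟶ X) : IsMinor ((pullback f).map φ) k (f ⁻¹ᵁ U) (f.app U a) := by
  obtain ⟨p, q, e, h, A, s, t, he, hh, hA, hs, ht, rfl⟩ := ha
  refine ⟨p, q, _, _, _, s, t, he.pullback f, hh.pullback f, IsMatrixOf.pullback f hA, hs, ht, ?_⟩
  rw [Matrix.submatrix_map, ← RingHom.mapMatrix_apply, ← RingHom.map_det]

lemma IsMinor.germ_mem {φ : E ⟶ F} {k : ℕ} {U : X.Opens} {a : Γ(X, U)} (ha : IsMinor φ k U a)
    {ι κ : Type} [Finite ι] [Fintype κ] {V : X.Opens} {e : ι → Γ(E, V)} {h : κ → Γ(F, V)}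
    {A : Matrix κ ι Γ(X, V)} (he : IsFrame E V e) (hh : IsFrame F V h) (hA : IsMatrixOf φ e h A)
    {x : X} (hxU : x ∈ U) (hxV : x ∈ V) :
    X.presheaf.germ U x hxU a ∈ (A.minorIdeal k).map (X.presheaf.germ V x hxV).hom := by
  obtain ⟨p', q', e', h', A', he', hh', hA', ha⟩ := ha.exists_mem
  have hW : x ∈ V ⊓ U := ⟨hxV, hxU⟩
  have key := (hA.restrict (inf_le_left : V ⊓ U ≤ V)).minorIdeal_eq
    (hA'.restrict (inf_le_right : V ⊓ U ≤ U)) (he.restrict _) (hh.restrict _)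
    (he'.restrict _) (hh'.restrict _) k
  rw [Matrix.minorIdeal_map, Matrix.minorIdeal_map] at key
  rw [← IdealSheafData.map_germ_res inf_le_left _ hW, key, IdealSheafData.map_germ_res]
  exact Ideal.mem_map_of_mem _ ha

/-- A morphism that maps associated points to `φ`-regular points and diagonalizes `φ` locally makes
the pullbacks of the determinantal ideals invertible. -/
lemma isInvertibleAlong_determinantalIdeal [IsLocallyNoetherian Z] {T : Scheme.{u}}
    (hE : IsLocallyFreeOfFiniteRank E) (hF : IsLocallyFreeOfFiniteRank F) (φ : E ⟶ F)
    (g : Z ⟶ T) (h : T ⟶ X)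
    (hf : ∀ z : Z, IsAssociatedPoint z → IsRegularPoint φ ((g ≫ h) z))
    (hφ : IsLocallyDiagonalizable ((pullback (g ≫ h)).map φ)) {k : ℕ} (hk : k < imageRank φ) :
    (determinantalIdeal ((pullback h).map φ) k).IsInvertibleAlong g := by
  classical
  intro z
  obtain ⟨W, hzW, l, a, b, n, e, e', p, he, he', -, hp, h0, h1⟩ := hφ z
  obtain ⟨U₀, c, d, u, v, A, hz₀, hu, hv, hA⟩ := exists_isMatrixOf hE hF φ ((g ≫ h) z)
  let σ := Σ i : Fin l, Fin (n i)
  let D : Matrix (Fin b ⊕ σ) (Fin a ⊕ σ) Γ(Z, W) :=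
    Matrix.diagonalBlock (Fin b) (Fin a) fun x : σ => p x.1
  have hD : IsMatrixOf ((Modules.pullback (g ≫ h)).map φ) e e' D := by
    rintro (j | ⟨i, j⟩)
    · rw [h0]
      simp [D]
    · rw [h1]
      simp [D, Matrix.diagonal_apply, ite_smul]
  have hz₁ : g z ∈ h ⁻¹ᵁ U₀ := by simpa using hz₀
  obtain ⟨_, ⟨U, hU, rfl⟩, hzU, hUU⟩ := T.isBasis_affineOpens.exists_subset_of_mem_open
    (show g z ∈ ((h ⁻¹ᵁ U₀ : T.Opens) : Set T) from hz₁) (h ⁻¹ᵁ U₀).isOpen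
  replace hUU : U ≤ h ⁻¹ᵁ U₀ := hUU
  obtain ⟨_, ⟨V, hV, rfl⟩, hzV, hVV⟩ := Z.isBasis_affineOpens.exists_subset_of_mem_open
    (show z ∈ ((g ⁻¹ᵁ U ⊓ W : Z.Opens) : Set Z) from ⟨hzU, hzW⟩) (g ⁻¹ᵁ U ⊓ W).isOpen
  have hVU : V ≤ g ⁻¹ᵁ U := fun x hx => (hVV hx).1
  have hVW : V ≤ W := fun x hx => (hVV hx).2
  have hV₀ : V ≤ (g ≫ h) ⁻¹ᵁ U₀ := fun x hx => by simpa using hUU (hVU hx)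
  let ρ := (Z.presheaf.map (homOfLE hVW).op).hom
  have hDV : D.map ρ = Matrix.diagonalBlock (Fin b) (Fin a) fun x : σ => ρ (p x.1) := by
    simp only [D, Matrix.diagonalBlock, Matrix.fromBlocks_map]
    congr 1
    · ext; simp
    · ext; simp
    · ext; simp
    · ext i j
      by_cases hij : i = j
      · subst hij; simp
      · simp [hij]
  -- The matrix `A`, mapped to `V` through `T` or directly from `X`, gives the same entries, and
  -- over `V` it represents the same map as `D`. Thus the functors of pullback along `g ≫ h` and in
  -- two steps need not be compared.
  have hideal : ((determinantalIdeal ((Modules.pullback h).map φ) k).ideal ⟨U, hU⟩).map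
      (g.appLE U V hVU).hom = (D.map ρ).minorIdeal (k + 1) := by
    rw [determinantalIdeal_ideal_eq (U := ⟨U, hU⟩) (hE.pullback h) (hF.pullback h)
      ((hu.pullback h).restrict hUU) ((hv.pullback h).restrict hUU)
      ((IsMatrixOf.pullback h hA).restrict hUU)]
    rw [← (((IsMatrixOf.pullback (g ≫ h) hA).restrict hV₀).minorIdeal_eq (hD.restrict hVW)
      ((hu.pullback _).restrict _) ((hv.pullback _).restrict _) (he.restrict _) (he'.restrict _)
      (k + 1))]
    simp only [Matrix.minorIdeal_map, Ideal.map_map, ← CommRingCat.hom_comp]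
    congr 2
    rw [Category.assoc, Scheme.Hom.map_appLE, Scheme.Hom.app_eq_appLE, Scheme.Hom.appLE_comp_appLE]
    rfl
  have : IsNoetherianRing Γ(Z, V) := IsLocallyNoetherian.component_noetherian ⟨V, hV⟩
  -- The rank of a diagonal entry is the index of its block: the ideals of the `p i` decrease, so
  -- earlier entries divide later ones.
  obtain ⟨q, hq, hqD⟩ := Matrix.exists_minorIdeal_diagonalBlock_eq_span (β := Fin b) (α := Fin a)
    (rank := fun x : σ => (x.1 : ℕ)) (fun x : σ => ρ (p x.1)) (fun x y hxy => by
      refine map_dvd ρ (Ideal.span_singleton_le_span_singleton.1 (hp.antitone ?_))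
      exact hxy) (k := k + 1) (m := imageRank φ) hk fun P hP hle => by
    -- At the associated point given by `P`, regularity of its image provides an `m × m` minor that
    -- is a unit in the stalk, whereas `hle` would place all such minors in the maximal ideal.
    have hPp : P.IsPrime := hP.1
    let P' : PrimeSpectrum Γ(Z, V) := ⟨P, hPp⟩
    obtain ⟨U', s, hs, hy⟩ := hf _ (isAssociatedPoint_fromSpec hV P' hP)
    have hyV : hV.fromSpec P' ∈ V := hV.range_fromSpec.le ⟨P', rfl⟩
    have hyU : hV.fromSpec P' ∈ (g ≫ h) ⁻¹ᵁ U' := X.basicOpen_le s hy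
    have h2 := (hs.pullback (g ≫ h)).germ_mem (he.restrict hVW) (he'.restrict hVW)
      (hD.restrict hVW) hyU hyV
    have h3 : IsUnit (Z.presheaf.germ _ _ hyU ((g ≫ h).app U' s)) := by
      rw [← Scheme.mem_basicOpen, ← Scheme.preimage_basicOpen]
      exact hy
    refine (IsLocalRing.mem_maximalIdeal _).1 ?_ h3
    refine (Ideal.map_le_iff_le_comap.2 ?_) h2
    intro t ht
    exact germ_mem_maximalIdeal_fromSpec hV P' hyV (hle (hDV ▸ ht))
  exact ⟨U, hU, V, hV, hVU, hzV, q, hq, by rw [hideal, hDV, hqD]⟩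

end Modules

end AlgebraicGeometry.Scheme

theorem mainTheorem4 {X Z : Scheme.{u}} [IsNoetherian X] [IsLocallyNoetherian Z]
    {E F : X.Modules} (hE : Scheme.Modules.IsLocallyFreeOfFiniteRank E)
    (hF : Scheme.Modules.IsLocallyFreeOfFiniteRank F) (φ : E ⟶ F)
    (f : Z ⟶ X) [IsDominant f]
    (hf : ∀ z : Z, Scheme.IsAssociatedPoint z → Scheme.Modules.IsRegularPoint φ (f z))
    (hφ : Scheme.Modules.IsLocallyDiagonalizable ((Scheme.Modules.pullback f).map φ)) :
    ∃! g : Z ⟶ Scheme.Modules.detBlowup φ, g ≫ Scheme.Modules.detBlowupπ φ = f := by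
  suffices H : ∀ k ≤ Scheme.Modules.imageRank φ,
      ∃! g : Z ⟶ (Scheme.Modules.blowupTower φ k).left,
        g ≫ (Scheme.Modules.blowupTower φ k).hom = f from H _ le_rfl
  intro k
  induction k with
  | zero => exact fun _ => ⟨f, Category.comp_id f, fun g hg => (Category.comp_id g).symm.trans hg⟩
  | succ k ih =>
    intro hk
    obtain ⟨g, hg, hguniq⟩ := ih (by omega)
    replace hg : g ≫ (Scheme.Modules.blowupTower φ k).hom = f := hg
    subst hg
    obtain ⟨g', hg', hg'uniq⟩ := (Scheme.Modules.isInvertibleAlong_determinantalIdeal hE hF φ g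
      (Scheme.Modules.blowupTower φ k).hom hf hφ hk).existsUnique_blowup_lift
    refine ⟨g', (Category.assoc _ _ _).symm.trans congr($hg' ≫ _), fun g'' hg'' => ?_⟩
    -- Uniqueness at stage `k` identifies the composite of `g''` with the blow-up map as `g`, so
    -- that uniqueness of the lift of `g` applies.
    exact hg'uniq g'' (hguniq _ ((Category.assoc _ _ _).trans hg''))
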